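/- **Setting.** Let $e\ge 1$, $\ell\ge 0$, and let $I=\mathbb Z/(e+1)\mathbb Z$ be the vertex set of the cyclic quiver of type $A^{(1)}_e$ with edges $i\to i+1$. Let $\boldsymbol\lambda=(\lambda^{(1)}|\dots|\lambda^{(\ell)})$ be an $\ell$-partition of $n$, let $\boldsymbol\rho\in I^\ell$, and let $\boldsymbol\kappa\in\mathbb Z^\ell$ be an asymptotic charge: $\kappa_1<\dots<\kappa_\ell$ and $\kappa_{m}+n\le\kappa_{m'}$ for $m<m'$. The node $(m,r,c)$ has residue $\rho_m+c-r\in I$. Subdividing the edge $0\to1$ gives the quiver of type $A^{(1)}_{e+1}$; its vertices are named by $s:I\to \mathbb Z/(e+2)\mathbb Z$, $s(0)=0$, $s(i)=i+1$ for $1\le i\le e$, and the new vertex is $1$. **Idempotent diagrams.** For ghost shifts $\sigma_i>0$ of the edges $i\to i+1$, an idempotent diagram consists of vertical solid strings with positions and residues and vertical red strings with positions and residues; a solid $i$-string at $x$ has a ghost $i$-string at $x+\sigma_i$. For an $\ell$-partition $\boldsymbol\mu$ of $k$ on the quiver with $N$ vertices, with starting residues $\boldsymbol\rho$, the diagram $1_{\boldsymbol\mu}$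 has a red $\rho_m$-string at $\kappa_m$ for each $m$, and for each node $(m,r,c)$ of $\boldsymbol\mu$ a solid string labelled by the residue of the node at $$\kappa_m+w_m(c-r)-\frac{m}{\ell+kN}-(c+r)\eta ,$$ where $w_m(d)$ is the content $d$ measured with ghost shifts, $w_m(d)=\sum_{0\le j<d}\sigma_{\rho_m+j}-\sum_{d\le j<0}\sigma_{\rho_m+j}$, and $\eta>0$ satisfies $2k(\ell+kN)\eta<\min_i\sigma_i$. For unit ghost shifts $w_m(d)=d$. Two idempotent diagrams with the same ghost shifts and red strings are regarded as equal if the solid strings of one can be moved smoothly to those of the other (residues being preserved) so that at no time two solid strings of the same residue meet, or a ghost $i$-string and a solid $(i+1)$-string meet, or a solid $i$-string and a red $i$-string meet. (These are the crossings for which the Reidemeister II relation has a correction term; so equal diagrams are identified in the KLRW algebra by isotopies and Reidemeister II moves.) **Subdivision map.** In an idempotent diagram with unit ghost shifts, a close $(0,1)$-tuple is a non-empty sequence, from left to right, of alternating solid $1$-strings and ghost $0$-strings, consecutive members being neighbours (among these strings) at distance less than $\delta$; it is maximal if it cannot be expanded, and its starting residue is the residue of its rightmost string. The diagram $S_{t,\epsilon}(Y)$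 for the subdivided quiver has ghost shift $\epsilon$ on the new edge $1\to2$ and $1$ on the others; every solid and red $i$-string of $Y$ is kept and relabelled $s(i)$, and for each ghost $0$-string of $Y$ a solid $1$-string is added, $t$ units to the left of it if its maximal close tuple starts with $0$, and $t$ units to the right of it if that tuple starts with $1$. **The partition $\boldsymbol\lambda^+$.** A strip in $\lambda^{(m)}$ is a sequence of nodes of residues $0$ and $1$ in which each $0$-node is followed by the node to its right and each $1$-node by the node below it; it is maximal if it cannot be extended at either end, and its starting residue is that of its first node. Replace each $0$-node on a maximal strip starting with $0$ by a horizontal pair $\boxed{0}\,\boxed{1}$, pushing the rest of its row to the right; replace each $0$-node on a maximal strip starting with $1$ by a vertical pair with $1$ on top of $0$, pushing the rest of its column down; relabel every other $i$-node by $s(i)$. **Statement.** Let $1_{\boldsymbol\lambda}$ be formed with unit ghost shifts and an admissible $\eta$, let $\eta<\delta\le\frac12$, and let the subdivision be homogeneous: $t,\epsilon>0$ and $t+\epsilon<\eta$. Then the filled box configurations obtained in this way from the components of $\boldsymbol\lambda$ are those of an $\ell$-partition $\boldsymbol\lambda^+$, filled with residues for the starting residues $s(\rho_1),\dots,s(\rho_\ell)$,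 and $$S_{t,\epsilon}(1_{\boldsymbol\lambda})=1_{\boldsymbol\lambda^+},$$ where $1_{\boldsymbol\lambda^+}$ is formed on the subdivided quiver with the charge $\boldsymbol\kappa$, the starting residues $s(\rho_m)$, ghost shift $\epsilon$ on the edge $1\to2$ and $1$ on the others, and any admissible value of its parameter $\eta$. -/

import Mathlib

open scoped ContDiff

noncomputable section

namespace KLRW

/-! ## Young diagrams filled with residues

The vertex set of the cyclic quiver of type `A_e^{(1)}` is `ZMod (e + 1)`, with one edge
`i → i + 1` for every vertex `i`.  A box is a pair `(row, column)`, both counted from `0`. -/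

/-- The residue of a box: residues start with `ρ` in the corner, increase along rows and decrease
down columns. -/
def boxRes {N : ℕ} (ρ : ZMod N) (a : ℕ × ℕ) : ZMod N := ρ + (a.2 : ZMod N) - (a.1 : ZMod N)

/-- The vertices after subdividing the edge `0 → 1`: the vertex `0` keeps its name, `i` becomes
`i + 1` for `1 ≤ i ≤ e`, and the new vertex (the middle of the subdivided edge) is called `1`. -/
def relabel {e : ℕ} (i : ZMod (e + 1)) : ZMod (e + 2) :=
  if i = 0 then 0 else ((i.val + 1 : ℕ) : ZMod (e + 2))

/-- The filled box configuration of a partition, as a collection of labelled boxes. -/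
def filledBoxes {N : ℕ} (ρ : ZMod N) (lam : YoungDiagram) : Multiset ((ℕ × ℕ) × ZMod N) :=
  lam.cells.val.map fun a => (a, boxRes ρ a)

/-- In a strip, a `0`-node is followed by the (`1`-)node to its right, and a `1`-node is followed
by the (`0`-)node below it. -/
def StripStep {N : ℕ} (ρ : ZMod N) (a b : ℕ × ℕ) : Prop :=
  (boxRes ρ a = 0 ∧ b = (a.1, a.2 + 1)) ∨ (boxRes ρ a = 1 ∧ b = (a.1 + 1, a.2))

/-- `l = (A₁, …, A_k)` is a strip of nodes of `lam` with alternating residues `0` and `1`.  It is a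
`(0,1)`-strip or a `(1,0)`-strip according to the residue of its first node. -/
def IsStrip {N : ℕ} (ρ : ZMod N) (lam : YoungDiagram) (l : List (ℕ × ℕ)) : Prop :=
  l ≠ [] ∧ (∀ a ∈ l, a ∈ lam.cells ∧ (boxRes ρ a = 0 ∨ boxRes ρ a = 1)) ∧
    l.IsChain (StripStep ρ)

/-- A strip is maximal if it cannot be completed into a larger one, at either end. -/
def IsMaximalStrip {N : ℕ} (ρ : ZMod N) (lam : YoungDiagram) (l : List (ℕ × ℕ)) : Prop :=
  IsStrip ρ lam l ∧ ∀ l', IsStrip ρ lam l' → l <:+: l' → l' = l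

/-- The node `a` lies on a maximal strip of `lam` whose starting residue is `i`. -/
def OnStrip {N : ℕ} (ρ : ZMod N) (lam : YoungDiagram) (i : ZMod N) (a : ℕ × ℕ) : Prop :=
  ∃ l, IsMaximalStrip ρ lam l ∧ a ∈ l ∧ ∃ b, l.head? = some b ∧ boxRes ρ b = i

open Classical in
/-- The number of `0`-nodes to the left of `a` in its row that lie on a maximal strip starting
with `0`.  Each of them gets a new box on its right, so `a` moves right by this number. -/
def pushRight {N : ℕ} (ρ : ZMod N) (lam : YoungDiagram) (a : ℕ × ℕ) : ℕ :=
  (lam.cells.filter fun b => b.1 = a.1 ∧ b.2 < a.2 ∧ boxRes ρ b = 0 ∧ OnStrip ρ lam 0 b).card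

open Classical in
/-- The number of `0`-nodes above `a` in its column that lie on a maximal strip starting
with `1`.  Each of them gets a new box on top of it, so `a` moves down by this number. -/
def pushDown {N : ℕ} (ρ : ZMod N) (lam : YoungDiagram) (a : ℕ × ℕ) : ℕ :=
  (lam.cells.filter fun b => b.2 = a.2 ∧ b.1 < a.1 ∧ boxRes ρ b = 0 ∧ OnStrip ρ lam 1 b).card

open Classical in
/-- The labelled boxes replacing the node `a`.  On a maximal strip starting with `0`, every
`0`-node becomes a horizontal pair `0,1`; on a maximal strip starting with `1`, every `0`-node
becomes a vertical pair with `1` on top of `0`; every other node is only relabelled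
(so `1` becomes `2`). -/
def replaceBox {e : ℕ} (ρ : ZMod (e + 1)) (lam : YoungDiagram) (a : ℕ × ℕ) :
    Multiset ((ℕ × ℕ) × ZMod (e + 2)) :=
  let r := a.1 + pushDown ρ lam a
  let c := a.2 + pushRight ρ lam a
  if boxRes ρ a = 0 ∧ OnStrip ρ lam 0 a then {((r, c), 0), ((r, c + 1), 1)}
  else if boxRes ρ a = 0 ∧ OnStrip ρ lam 1 a then {((r, c), 1), ((r + 1, c), 0)}
  else {((r, c), relabel (boxRes ρ a))}

/-- The filled box configuration of `lam⁺`, obtained by replacing all maximal strips. -/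
def plusBoxes {e : ℕ} (ρ : ZMod (e + 1)) (lam : YoungDiagram) :
    Multiset ((ℕ × ℕ) × ZMod (e + 2)) :=
  lam.cells.val.bind (replaceBox ρ lam)

/-- `mu` is the `ℓ`-partition `lam⁺`: in every component, its box configuration, filled with
residues for the relabelled starting residue, is the one obtained by replacing all maximal
strips. -/
def IsPlus {e ℓ : ℕ} (ρ : Fin ℓ → ZMod (e + 1)) (lam mu : Fin ℓ → YoungDiagram) : Prop :=
  ∀ m, filledBoxes (relabel (ρ m)) (mu m) = plusBoxes (ρ m) (lam m)

/-! ## Idempotent diagrams -/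

/-- An idempotent diagram for the cyclic quiver on `ZMod N`: all strings are vertical, without dots
and crossings.  It is determined by the ghost shift `shift i` of every edge `i → i + 1`, the
positions and residues of the red strings, and the (unordered) collection of the positions and
residues of the solid strings.  A solid `i`-string at `x` has its ghost at `x + shift i`. -/
structure IdempotentDiagram (N ℓ : ℕ) where
  shift : ZMod N → ℝ
  redPos : Fin ℓ → ℝ
  redRes : Fin ℓ → ZMod N
  solid : Multiset (ℝ × ZMod N)

/-- `Y` and `Z` are equal as idempotents, up to isotopy and pulling strings: there is a diagram
of smooth strings `str j` without dots, with bottom `Y` and top `Z`, in which strings cross only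
if the Reidemeister II relation holds for them without correction terms.  The exceptional pairs,
which must never meet, are: two solid strings of the same residue; a ghost `i`-string and a solid
`(i + 1)`-string; a solid string and a red string of the same residue.

Such a diagram `D` has degree zero, and `D D⋆`, `D⋆ D` are the idempotents `Z` and `Y`. -/
def IdempotentDiagram.Equivalent {N ℓ : ℕ} (Y Z : IdempotentDiagram N ℓ) : Prop :=
  Z.shift = Y.shift ∧ Z.redPos = Y.redPos ∧ Z.redRes = Y.redRes ∧
  ∃ (k : ℕ) (res : Fin k → ZMod N) (str : Fin k → ℝ → ℝ),
    (∀ j, ContDiff ℝ ∞ (str j)) ∧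
    Y.solid = (Finset.univ : Finset (Fin k)).val.map (fun j => (str j 0, res j)) ∧
    Z.solid = (Finset.univ : Finset (Fin k)).val.map (fun j => (str j 1, res j)) ∧
    ∀ s ∈ Set.Icc (0 : ℝ) 1,
      (∀ j j', j ≠ j' → res j = res j' → str j s ≠ str j' s) ∧
      (∀ j j', res j' = res j + 1 → str j s + Y.shift (res j) ≠ str j' s) ∧
      (∀ j m, res j = Y.redRes m → str j s ≠ Y.redPos m)

/-- The content `d` measured with ghost shifts: the signed sum of the ghost shifts of the edges
that are passed on the way from the vertex `ρ` to the vertex `ρ + d`. -/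
def weightedContent {N : ℕ} (σ : ZMod N → ℝ) (ρ : ZMod N) (d : ℤ) : ℝ :=
  ∑ k ∈ Finset.Ico 0 d, σ (ρ + (k : ZMod N)) - ∑ k ∈ Finset.Ico d 0, σ (ρ + (k : ZMod N))

/-- For unit ghost shifts this is the usual content. -/
theorem weightedContent_one {N : ℕ} (ρ : ZMod N) (d : ℤ) :
    weightedContent (fun _ => 1) ρ d = d := by
  rcases le_total 0 d with h | h
  · have h1 : (d.toNat : ℝ) = d := by exact_mod_cast Int.toNat_of_nonneg h
    simp [weightedContent, Finset.Ico_eq_empty_of_le h, h1]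
  · have h1 : ((-d).toNat : ℝ) = ((-d : ℤ) : ℝ) := by
      exact_mod_cast Int.toNat_of_nonneg (by omega : 0 ≤ -d)
    simp [weightedContent, Finset.Ico_eq_empty_of_le h, h1]

/-- The number of nodes of an `ℓ`-partition. -/
def size {ℓ : ℕ} (lam : Fin ℓ → YoungDiagram) : ℕ := ∑ m, (lam m).cells.card

/-- The number `ℓ + n (e + 1)` entering the positioning function; here `N = e + 1` is the number
of vertices. -/
def affineLevel (N : ℕ) {ℓ : ℕ} (lam : Fin ℓ → YoungDiagram) : ℕ := ℓ + size lam * N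

/-- The positioning function.  For unit ghost shifts the `m`-th component has its node in row `r`
and column `c` (all counted from `1`) at
`κ_m + (c - r) - m / (ℓ + n (e + 1)) - (c + r) η`. -/
def coord {N ℓ : ℕ} (σ : ZMod N → ℝ) (κ : Fin ℓ → ℤ) (ρ : Fin ℓ → ZMod N) (η : ℝ)
    (lam : Fin ℓ → YoungDiagram) (m : Fin ℓ) (a : ℕ × ℕ) : ℝ :=
  (κ m : ℝ) + weightedContent σ (ρ m) ((a.2 : ℤ) - (a.1 : ℤ))
    - ((m : ℝ) + 1) / (affineLevel N lam : ℝ) - ((a.2 : ℝ) + (a.1 : ℝ) + 2) * η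

/-- The idempotent diagram attached to an `ℓ`-partition. -/
def partitionIdempotent {N ℓ : ℕ} (σ : ZMod N → ℝ) (κ : Fin ℓ → ℤ) (ρ : Fin ℓ → ZMod N) (η : ℝ)
    (lam : Fin ℓ → YoungDiagram) : IdempotentDiagram N ℓ where
  shift := σ
  redPos := fun m => (κ m : ℝ)
  redRes := ρ
  solid := ∑ m, (lam m).cells.val.map fun a => (coord σ κ ρ η lam m a, boxRes (ρ m) a)

/-- The admissible values of the small parameter in the positioning function.  For unit ghost
shifts this is `0 < η < 1 / (2 n (ℓ + n (e + 1)))`. -/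
def IsSpacing {N ℓ : ℕ} (σ : ZMod N → ℝ) (lam : Fin ℓ → YoungDiagram) (η : ℝ) : Prop :=
  0 < η ∧ ∀ i, 2 * (size lam : ℝ) * (affineLevel N lam : ℝ) * η < σ i

/-- An integral charge is asymptotic, for `n` solid strings, if it is strictly increasing with gaps
of size at least `n`. -/
def IsAsymptotic {ℓ : ℕ} (n : ℕ) (κ : Fin ℓ → ℤ) : Prop :=
  StrictMono κ ∧ ∀ m m' : Fin ℓ, m < m' → κ m + (n : ℤ) ≤ κ m'

/-! ## The subdivision map on idempotent diagrams -/

/-- The solid `1`-strings and the ghost `0`-strings of a diagram, as pairs of a position and the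
residue `1`, respectively `0`. -/
def marked {N ℓ : ℕ} (Y : IdempotentDiagram N ℓ) : Multiset (ℝ × ZMod N) :=
  Y.solid.filter (fun p => p.2 = 1) +
    (Y.solid.filter (fun p => p.2 = 0)).map (fun p => (p.1 + Y.shift 0, 0))

/-- A close `(0,1)`-tuple, listed from left to right: solid `1`-strings and ghost `0`-strings
alternate, and consecutive members are neighbours at distance less than `δ`. -/
def IsCloseTuple {N ℓ : ℕ} (δ : ℝ) (Y : IdempotentDiagram N ℓ) (l : List (ℝ × ZMod N)) : Prop :=
  l ≠ [] ∧ (∀ a ∈ l, a ∈ marked Y) ∧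
    l.IsChain fun a b => a.1 < b.1 ∧ b.1 - a.1 < δ ∧ a.2 ≠ b.2 ∧
      ∀ c ∈ marked Y, ¬ (a.1 < c.1 ∧ c.1 < b.1)

/-- A close tuple is maximal if it cannot be expanded. -/
def IsMaximalCloseTuple {N ℓ : ℕ} (δ : ℝ) (Y : IdempotentDiagram N ℓ) (l : List (ℝ × ZMod N)) :
    Prop :=
  IsCloseTuple δ Y l ∧ ∀ l', IsCloseTuple δ Y l' → l <:+: l' → l' = l

/-- The ghost `0`-string at position `g` lies in a maximal close tuple with starting residue `i`;
the starting residue is that of the rightmost string. -/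
def InTuple {N ℓ : ℕ} (δ : ℝ) (Y : IdempotentDiagram N ℓ) (i : ZMod N) (g : ℝ) : Prop :=
  ∃ l, IsMaximalCloseTuple δ Y l ∧ (g, 0) ∈ l ∧ ∃ b, l.getLast? = some b ∧ b.2 = i

/-- The ghost shift after subdividing the edge `0 → 1`: the new edge `1 → 2` has ghost shift `ε`,
and all old edges keep theirs. -/
def subdivideShift {e : ℕ} (ε : ℝ) (σ : ZMod (e + 1) → ℝ) (i : ZMod (e + 2)) : ℝ :=
  if i = 1 then ε else if i = 0 then σ 0 else σ ((i.val - 1 : ℕ) : ZMod (e + 1))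

open Classical in
/-- The `(t, ε)`-subdivision map on idempotent diagrams.  All strings are kept and relabelled, and
for every ghost `0`-string a solid `1`-string is added: `t` units to its left if the maximal close
tuple containing it starts with `0`, and `t` units to its right if that tuple starts with `1`.
The ghosts of the added strings are `ε` units to the right of them. -/
def subdivide {e ℓ : ℕ} (t ε δ : ℝ) (Y : IdempotentDiagram (e + 1) ℓ) :
    IdempotentDiagram (e + 2) ℓ where
  shift := subdivideShift ε Y.shift
  redPos := Y.redPos
  redRes := fun m => relabel (Y.redRes m)
  solid := Y.solid.map (fun p => (p.1, relabel p.2)) +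
    ((Y.solid.filter fun p => p.2 = 0).map fun p => p.1 + Y.shift 0).bind fun g =>
      if InTuple δ Y 0 g then {(g - t, 1)}
      else if InTuple δ Y 1 g then {(g + t, 1)}
      else 0

/-- The subdivision is homogeneous if `t` and `ε` are small positive numbers: the added strings
and their ghosts stay within the spacing `η` of the strings of the diagram. -/
def IsHomogeneous (η t ε : ℝ) : Prop := 0 < t ∧ 0 < ε ∧ t + ε < η

end KLRW

end

noncomputable section

namespace KLRW

/-! ## Extending lists to maximal ones -/

/-! A strip zigzags between two neighbouring diagonals, so its `0`-nodes all have one content `d`.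
Traced backwards it can only stop at the border of the diagram: at a `0`-node in the first row,
whence `d ≥ 0`, or at a `1`-node in the first column, whence `d < 0`. The starting residue thus
records the sign of `d` (`onStrip_zero_iff`, `onStrip_one_iff`). In the idempotent, the marked
strings (solid `1`, ghost `0`) of consecutive nodes of a strip are `η` apart, while those from other
diagonals or components are at least `1/2` away; the same argument therefore reads the sign of `d`
off a close tuple (`inTuple_iff`).

This makes `lam⁺` explicit. Let `w = crossings ρ d` count, with sign, the passages of the edge `0 →
1` between `ρ` and `ρ + d`. A node of content `d` moves right by `w`, or down by `-w`, and the box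
added for a `0`-node is displaced by `w + 1` instead. The new contents `d + w` and `d + w + 1` never
coincide for different diagonals, and a check of left and upper neighbours shows that the boxes form
a Young diagram. On the subdivided quiver `d` steps become `d + w` steps, of which `w` have length
`ε`, so the weighted content is `d + ε w`: the old position up to a small error.

Both diagrams then have solid strings with the same index set and labels, each at an integral
diagonal plus a small shift. Straight-line motion works once every exceptional difference has the
same sign at both ends (`equivalent_of_sameSide`). Across diagonals or components the asymptotic
charge gives a gap of at least `2/3`, which beats the small shifts (`sameSide_of_base`). On one
diagonal the `ε`-terms cancel and the order is that of row plus column; an added box changes this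
sum by `|w + 1| - |w| = ±1`, with the sign matching the displacement by `t`
(`sameSide_of_newRes_add_one`). Red strings never have the new label, and inherited strings stay on
their side of them (`sameSide_red`). -/

theorem exists_maximal_infix {α : Type*} (P : List α → Prop) (N : ℕ)
    (hN : ∀ l, P l → l.length ≤ N) (l₀ : List α) (h₀ : P l₀) :
    ∃ l, P l ∧ l₀ <:+: l ∧ ∀ l', P l' → l <:+: l' → l' = l := by
  classical
  -- Minimising the deficit `N - l.length` picks a longest list containing `l₀`.
  have hex : ∃ k, ∃ l, P l ∧ l₀ <:+: l ∧ N - l.length = k := ⟨_, l₀, h₀, List.infix_refl _, rfl⟩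
  obtain ⟨l, hl, hl₀, hk⟩ := Nat.find_spec hex
  refine ⟨l, hl, hl₀, fun l' hl' hll' => ?_⟩
  have h1 := Nat.find_min' hex ⟨l', hl', hl₀.trans hll', rfl⟩
  have h2 := hN l hl
  have h3 := hN l' hl'
  have h4 := hll'.length_le
  exact (hll'.eq_of_length (by omega)).symm

/-- Turns an invariant of single steps into an invariant of a whole strip or tuple. An equivalence
is required at each step because the member where `Q` is known may lie anywhere in the list. -/
theorem _root_.List.IsChain.forall_mem_of_iff {α : Type*} {R : α → α → Prop} {Q : α → Prop}
    {l : List α} (hl : l.IsChain R)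
    (hQ : ∀ a ∈ l, ∀ b ∈ l, R a b → (Q a ↔ Q b)) {x : α} (hx : x ∈ l) (h : Q x) :
    ∀ y ∈ l, Q y := by
  induction l generalizing x with
  | nil => simp at hx
  | cons a l ih =>
    cases l with
    | nil =>
      intro y hy
      simp only [List.mem_singleton] at hx hy
      rw [hy, ← hx]
      exact h
    | cons b l =>
      rw [List.isChain_cons_cons] at hl
      have hab : Q a ↔ Q b := hQ a (by simp) b (by simp) hl.1
      have ih' := fun x hx h => ih (x := x) hl.2
        (fun a ha b hb => hQ a (List.mem_cons_of_mem _ ha) b (List.mem_cons_of_mem _ hb)) hx h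
      have hb : Q b := by
        rcases List.mem_cons.1 hx with rfl | hx
        · exact hab.1 h
        · exact ih' x hx h b (by simp)
      intro y hy
      rcases List.mem_cons.1 hy with rfl | hy
      · exact hab.2 hb
      · exact ih' b (by simp) hb y hy

/-! ## Strips -/

/-- The content of a box. -/
def content (a : ℕ × ℕ) : ℤ := (a.2 : ℤ) - (a.1 : ℤ)

theorem boxRes_eq {N : ℕ} (ρ : ZMod N) (a : ℕ × ℕ) :
    boxRes ρ a = ρ + ((content a : ℤ) : ZMod N) := by
  simp [boxRes, content, add_sub_assoc]

theorem zero_ne_one_zmod {e : ℕ} (he : 1 ≤ e) : (0 : ZMod (e + 1)) ≠ 1 := by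
  have : Fact (1 < e + 1) := ⟨by omega⟩
  exact zero_ne_one

section Strips

variable {e : ℕ} {ρ : ZMod (e + 1)} {lam : YoungDiagram}

/-- The content of the `0`-nodes on the strip through a node. -/
def stripContent (ρ : ZMod (e + 1)) (a : ℕ × ℕ) : ℤ :=
  if boxRes ρ a = 0 then content a else content a - 1

/-- A step right raises the content by one and reaches a `1`-node, a step down lowers it again;
subtracting one at `1`-nodes evens this out. -/
theorem stripContent_eq_of_step (he : 1 ≤ e) {a b : ℕ × ℕ} (h : StripStep ρ a b) :
    stripContent ρ b = stripContent ρ a := by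
  have h01 := zero_ne_one_zmod he
  rcases h with ⟨h, rfl⟩ | ⟨h, rfl⟩
  · have : boxRes ρ (a.1, a.2 + 1) = 1 := by
      simp only [boxRes] at h ⊢
      push_cast
      linear_combination h
    simp [stripContent, this, h, h01.symm, content]
    ring
  · have : boxRes ρ (a.1 + 1, a.2) = 0 := by
      simp only [boxRes] at h ⊢
      push_cast
      linear_combination h
    simp [stripContent, this, h, h01.symm, content]
    ring

/-- Row plus column grows along a strip, so no node is repeated. -/
theorem IsStrip.length_le {l : List (ℕ × ℕ)} (h : IsStrip ρ lam l) :
    l.length ≤ lam.cells.card := by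
  classical
  have hp : l.Pairwise fun a b => a.1 + a.2 < b.1 + b.2 := by
    have hc : l.IsChain fun a b => a.1 + a.2 < b.1 + b.2 := by
      refine h.2.2.imp ?_
      rintro a b (⟨-, rfl⟩ | ⟨-, rfl⟩) <;> simp only <;> omega
    have : IsTrans (ℕ × ℕ) fun a b => a.1 + a.2 < b.1 + b.2 := ⟨fun a b c => lt_trans⟩
    exact List.isChain_iff_pairwise.1 hc
  have hn : l.Nodup := hp.imp fun hab => by
    rintro rfl
    exact lt_irrefl _ hab
  rw [← List.toFinset_card_of_nodup hn]
  exact Finset.card_le_card fun a ha => (h.2.1 a (List.mem_toFinset.1 ha)).1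

theorem exists_maximalStrip {a : ℕ × ℕ} (ha : a ∈ lam.cells) (h0 : boxRes ρ a = 0) :
    ∃ l, IsMaximalStrip ρ lam l ∧ a ∈ l := by
  obtain ⟨l, hl, hal, hm⟩ := exists_maximal_infix (IsStrip ρ lam) _
    (fun l h => h.length_le) [a] ⟨by simp, by simpa using ⟨ha, Or.inl h0⟩, by simp⟩
  exact ⟨l, ⟨hl, hm⟩, hal.subset (by simp)⟩

theorem IsMaximalStrip.not_step {l : List (ℕ × ℕ)} {a b : ℕ × ℕ} (h : IsMaximalStrip ρ lam l)
    (hb : l.head? = some b) (ha : a ∈ lam.cells) (h01 : boxRes ρ a = 0 ∨ boxRes ρ a = 1) :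
    ¬ StripStep ρ a b := by
  intro hab
  have h1 : IsStrip ρ lam (a :: l) := by
    refine ⟨by simp, ?_, ?_⟩
    · intro x hx
      rcases List.mem_cons.1 hx with rfl | hx
      · exact ⟨ha, h01⟩
      · exact h.1.2.1 x hx
    · refine List.isChain_cons.2 ⟨?_, h.1.2.2⟩
      intro y hy
      rw [hb] at hy
      obtain rfl : b = y := by simpa using hy
      exact hab
  have := congrArg List.length (h.2 _ h1 (List.suffix_cons a l).isInfix)
  simp at this

/-- If the sign were wrong, the first node would have a left neighbour (for a `1`-node) or an upper
neighbour (for a `0`-node). It lies in `lam` because `lam` is a lower set, and it would prolong the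
strip. -/
theorem IsMaximalStrip.stripContent_nonneg_iff (he : 1 ≤ e) {l : List (ℕ × ℕ)} {b : ℕ × ℕ}
    (h : IsMaximalStrip ρ lam l) (hb : l.head? = some b) :
    0 ≤ stripContent ρ b ↔ boxRes ρ b = 0 := by
  have h01 := zero_ne_one_zmod he
  have hbl : b ∈ l := List.mem_of_mem_head? hb
  obtain ⟨hbm, hres⟩ := h.1.2.1 b hbl
  obtain ⟨r, c⟩ := b
  constructor
  · intro hn
    by_contra h0
    have h1 := hres.resolve_left h0
    simp only [stripContent, h0, if_false, content] at hn
    obtain ⟨c, rfl⟩ : ∃ c', c = c' + 1 := ⟨c - 1, by omega⟩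
    have hres' : boxRes ρ (r, c) = 0 := by
      simp only [boxRes] at h1 ⊢
      push_cast at h1
      linear_combination h1
    refine h.not_step hb (a := (r, c)) ?_ (Or.inl hres') (Or.inl ⟨hres', rfl⟩)
    exact lam.isLowerSet (show (r, c) ≤ (r, c + 1) from ⟨le_rfl, Nat.le_succ _⟩) hbm
  · intro h0
    by_contra hn
    simp only [stripContent, h0, if_true, content] at hn
    obtain ⟨r, rfl⟩ : ∃ r', r = r' + 1 := ⟨r - 1, by omega⟩
    have hres' : boxRes ρ (r, c) = 1 := by
      simp only [boxRes] at h0 ⊢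
      push_cast at h0
      linear_combination h0
    refine h.not_step hb (a := (r, c)) ?_ (Or.inr hres') (Or.inr ⟨hres', rfl⟩)
    exact lam.isLowerSet (show (r, c) ≤ (r + 1, c) from ⟨Nat.le_succ _, le_rfl⟩) hbm

theorem IsMaximalStrip.content_nonneg_iff (he : 1 ≤ e) {l : List (ℕ × ℕ)} {a b : ℕ × ℕ}
    (h : IsMaximalStrip ρ lam l) (hb : l.head? = some b) (ha : a ∈ l) (h0 : boxRes ρ a = 0) :
    0 ≤ content a ↔ boxRes ρ b = 0 := by
  have := List.IsChain.forall_mem_of_iff (Q := fun x => stripContent ρ x = stripContent ρ a)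
    h.1.2.2 (fun x _ y _ hxy => by rw [stripContent_eq_of_step he hxy]) ha rfl b
    (List.mem_of_mem_head? hb)
  rw [← h.stripContent_nonneg_iff he hb, this, stripContent, if_pos h0]

theorem onStrip_zero_iff (he : 1 ≤ e) {a : ℕ × ℕ} (ha : a ∈ lam.cells) (h0 : boxRes ρ a = 0) :
    OnStrip ρ lam 0 a ↔ 0 ≤ content a := by
  constructor
  · rintro ⟨l, hl, hal, b, hb, hb0⟩
    exact (hl.content_nonneg_iff he hb hal h0).2 hb0
  · intro hn
    obtain ⟨l, hl, hal⟩ := exists_maximalStrip ha h0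
    obtain ⟨b, hb⟩ : ∃ b, l.head? = some b := ⟨l.head hl.1.1, List.head?_eq_some_head _⟩
    exact ⟨l, hl, hal, b, hb, (hl.content_nonneg_iff he hb hal h0).1 hn⟩

theorem onStrip_one_iff (he : 1 ≤ e) {a : ℕ × ℕ} (ha : a ∈ lam.cells) (h0 : boxRes ρ a = 0) :
    OnStrip ρ lam 1 a ↔ content a < 0 := by
  constructor
  · rintro ⟨l, hl, hal, b, hb, hb0⟩
    by_contra hn
    rw [(hl.content_nonneg_iff he hb hal h0).1 (not_lt.1 hn)] at hb0
    exact zero_ne_one_zmod he hb0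
  · intro hn
    obtain ⟨l, hl, hal⟩ := exists_maximalStrip ha h0
    obtain ⟨b, hb⟩ : ∃ b, l.head? = some b := ⟨l.head hl.1.1, List.head?_eq_some_head _⟩
    refine ⟨l, hl, hal, b, hb, ?_⟩
    refine (hl.1.2.1 b (List.mem_of_mem_head? hb)).2.resolve_left fun hb0 => ?_
    exact absurd ((hl.content_nonneg_iff he hb hal h0).2 hb0) (not_le.2 hn)

end Strips

/-! ## Crossing the subdivided edge -/

/-- The signed number of times that the edge `0 → 1` is passed on the way from `ρ` to `ρ + d`. -/
def crossings {N : ℕ} (ρ : ZMod N) (d : ℤ) : ℤ :=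
  ((Finset.Ico 0 d).filter fun k : ℤ => ρ + (k : ZMod N) = 0).card
    - ((Finset.Ico d 0).filter fun k : ℤ => ρ + (k : ZMod N) = 0).card

@[simp] theorem crossings_zero {N : ℕ} (ρ : ZMod N) : crossings ρ 0 = 0 := by simp [crossings]

/-- The recursion is uniform in the sign of `d`, so later arguments about `crossings` can run by
integer induction. -/
theorem crossings_add_one {N : ℕ} (ρ : ZMod N) (d : ℤ) :
    crossings ρ (d + 1) = crossings ρ d + if ρ + (d : ZMod N) = 0 then 1 else 0 := by
  rcases le_or_gt 0 d with h | h
  · have h1 : Finset.Ico 0 (d + 1) = insert d (Finset.Ico 0 d) := by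
      ext k
      simp only [Finset.mem_Ico, Finset.mem_insert]
      omega
    rw [crossings, crossings, h1, Finset.Ico_eq_empty_of_le h,
      Finset.Ico_eq_empty_of_le (by omega : (0 : ℤ) ≤ d + 1), Finset.filter_insert]
    split_ifs <;> simp
  · have h1 : Finset.Ico d 0 = insert d (Finset.Ico (d + 1) 0) := by
      ext k
      simp only [Finset.mem_Ico, Finset.mem_insert]
      omega
    rw [crossings, crossings, h1, Finset.Ico_eq_empty_of_le h.le,
      Finset.Ico_eq_empty_of_le (by omega : d + 1 ≤ (0 : ℤ)), Finset.filter_insert]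
    split_ifs <;> simp

theorem weightedContent_zero {N : ℕ} (σ : ZMod N → ℝ) (ρ : ZMod N) :
    weightedContent σ ρ 0 = 0 := by simp [weightedContent]

theorem weightedContent_add_one {N : ℕ} (σ : ZMod N → ℝ) (ρ : ZMod N) (d : ℤ) :
    weightedContent σ ρ (d + 1) = weightedContent σ ρ d + σ (ρ + (d : ZMod N)) := by
  rcases le_or_gt 0 d with h | h
  · have h1 : Finset.Ico 0 (d + 1) = insert d (Finset.Ico 0 d) := by
      ext k
      simp only [Finset.mem_Ico, Finset.mem_insert]
      omega
    rw [weightedContent, weightedContent, h1, Finset.Ico_eq_empty_of_le h,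
      Finset.Ico_eq_empty_of_le (by omega : (0 : ℤ) ≤ d + 1), Finset.sum_insert (by simp)]
    simp [add_comm]
  · have h1 : Finset.Ico d 0 = insert d (Finset.Ico (d + 1) 0) := by
      ext k
      simp only [Finset.mem_Ico, Finset.mem_insert]
      omega
    rw [weightedContent, weightedContent, h1, Finset.Ico_eq_empty_of_le h.le,
      Finset.Ico_eq_empty_of_le (by omega : d + 1 ≤ (0 : ℤ)), Finset.sum_insert (by simp)]
    ring

theorem crossings_nonneg {N : ℕ} (ρ : ZMod N) {d : ℤ} (h : 0 ≤ d) : 0 ≤ crossings ρ d := by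
  simp [crossings, Finset.Ico_eq_empty_of_le h]

theorem crossings_nonpos {N : ℕ} (ρ : ZMod N) {d : ℤ} (h : d ≤ 0) : crossings ρ d ≤ 0 := by
  simp [crossings, Finset.Ico_eq_empty_of_le h]

theorem abs_crossings_le {N : ℕ} (ρ : ZMod N) (d : ℤ) : |crossings ρ d| ≤ |d| := by
  have h1 := Finset.card_filter_le (Finset.Ico 0 d) fun k : ℤ => ρ + (k : ZMod N) = 0
  have h2 := Finset.card_filter_le (Finset.Ico d 0) fun k : ℤ => ρ + (k : ZMod N) = 0
  rw [Int.card_Ico] at h1 h2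
  rw [crossings, abs_le]
  rcases abs_cases d with h | h <;> constructor <;> omega

/-- The interval from `d` up to `0` contains `d` itself, which is counted when its residue is `0`.
-/
theorem crossings_neg_of_res {N : ℕ} {ρ : ZMod N} {d : ℤ} (h : d < 0)
    (h0 : ρ + (d : ZMod N) = 0) : crossings ρ d ≤ -1 := by
  have h1 := crossings_add_one ρ d
  have h2 := crossings_nonpos ρ (d := d + 1) (by omega)
  rw [if_pos h0] at h1
  omega

theorem crossings_mono {N : ℕ} (ρ : ZMod N) : Monotone (crossings ρ) :=
  monotone_int_of_le_succ fun d => by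
    rw [crossings_add_one]
    split_ifs <;> omega

/-! ## Relabelling -/

section Relabel

variable {e : ℕ}

@[simp] theorem relabel_zero : relabel (0 : ZMod (e + 1)) = 0 := by simp [relabel]

theorem relabel_add_one (he : 1 ≤ e) (i : ZMod (e + 1)) :
    relabel (i + 1) = relabel i + 1 + if i = 0 then 1 else 0 := by
  have h01 := zero_ne_one_zmod he
  have : Fact (1 < e + 1) := ⟨by omega⟩
  by_cases hi : i = 0
  · subst hi
    simp [relabel, h01.symm, ZMod.val_one, one_add_one_eq_two]
  · simp only [hi, if_false, add_zero]
    -- The case `i = e`, where the representative wraps around.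
    by_cases hi1 : i + 1 = 0
    · have h1 : i.val = e := by
        have : i = ((e : ℕ) : ZMod (e + 1)) := by
          have h2 : ((e + 1 : ℕ) : ZMod (e + 1)) = 0 := ZMod.natCast_self _
          push_cast at h2
          linear_combination hi1 - h2
        rw [this, ZMod.val_natCast, Nat.mod_eq_of_lt (by omega)]
      have h2 : ((e + 2 : ℕ) : ZMod (e + 2)) = 0 := ZMod.natCast_self _
      push_cast at h2
      simp only [relabel, hi1, hi, if_true, if_false, h1]
      push_cast
      linear_combination -h2
    · have h1 : (i + 1).val = i.val + 1 := by
        rw [ZMod.val_add, ZMod.val_one, Nat.mod_eq_of_lt]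
        have h2 := ZMod.val_lt i
        rcases Nat.lt_or_ge (i.val + 1) (e + 1) with h | h
        · exact h
        · exfalso
          apply hi1
          have h3 : i.val = e := by omega
          have h4 : i = ((e : ℕ) : ZMod (e + 1)) := by
            conv_lhs => rw [← ZMod.natCast_zmod_val i, h3]
          rw [h4]
          exact_mod_cast ZMod.natCast_self (e + 1)
      simp only [relabel, hi1, hi, if_false, h1]
      push_cast
      ring

theorem relabel_val (i : ZMod (e + 1)) :
    (relabel i).val = if i = 0 then 0 else i.val + 1 := by
  rw [relabel]
  split_ifs with h
  · simp
  · rw [ZMod.val_natCast, Nat.mod_eq_of_lt]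
    have := ZMod.val_lt i
    omega

theorem relabel_ne_one (i : ZMod (e + 1)) : relabel i ≠ 1 := by
  intro h
  have h1 := congrArg ZMod.val h
  have : Fact (1 < e + 2) := ⟨by omega⟩
  rw [relabel_val, ZMod.val_one] at h1
  split_ifs at h1 with hi
  apply hi
  apply ZMod.val_injective
  simpa using h1

theorem subdivideShift_relabel (ε : ℝ) (i : ZMod (e + 1)) :
    subdivideShift ε (fun _ : ZMod (e + 1) => 1) (relabel i) = 1 := by
  simp [subdivideShift, relabel_ne_one]

theorem subdivideShift_one (ε : ℝ) :
    subdivideShift ε (fun _ : ZMod (e + 1) => 1) 1 = ε := by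
  simp [subdivideShift]

/-- Every passage of the edge `0 → 1` costs one extra step on the subdivided quiver. -/
theorem relabel_add_content (he : 1 ≤ e) (ρ : ZMod (e + 1)) (d : ℤ) :
    relabel ρ + ((d + crossings ρ d : ℤ) : ZMod (e + 2)) = relabel (ρ + (d : ZMod (e + 1))) := by
  -- Stated as an equivalence so that it serves both directions of the integer induction.
  have key : ∀ d : ℤ,
      (relabel ρ + ((d + 1 + crossings ρ (d + 1) : ℤ) : ZMod (e + 2))
        = relabel (ρ + ((d + 1 : ℤ) : ZMod (e + 1)))) ↔
      (relabel ρ + ((d + crossings ρ d : ℤ) : ZMod (e + 2))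
        = relabel (ρ + (d : ZMod (e + 1)))) := by
    intro d
    have h1 : ρ + ((d + 1 : ℤ) : ZMod (e + 1)) = ρ + (d : ZMod (e + 1)) + 1 := by
      push_cast
      ring
    rw [h1, relabel_add_one he, crossings_add_one]
    split_ifs with h
    · push_cast
      constructor <;> intro h' <;> linear_combination h'
    · push_cast
      constructor <;> intro h' <;> linear_combination h'
  induction d with
  | zero => simp
  | succ d ih => exact (key d).2 ih
  | pred d ih =>
    have := key (-(d : ℤ) - 1)
    rw [sub_add_cancel] at this
    exact this.1 ih

/-- The `d` old steps keep length one, and each passage of the subdivided edge adds a step of length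
`ε`, all counted with sign. -/
theorem weightedContent_subdivideShift (he : 1 ≤ e) (ε : ℝ) (ρ : ZMod (e + 1)) (d : ℤ) :
    weightedContent (subdivideShift ε (fun _ : ZMod (e + 1) => 1)) (relabel ρ)
      (d + crossings ρ d) = d + ε * crossings ρ d := by
  set W := weightedContent (subdivideShift ε (fun _ : ZMod (e + 1) => 1)) (relabel ρ) with hW
  have key : ∀ d : ℤ, W (d + 1 + crossings ρ (d + 1)) = W (d + crossings ρ d) + 1
      + ε * (if ρ + (d : ZMod (e + 1)) = 0 then 1 else 0) := by
    intro d
    have h2 := relabel_add_content he ρ d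
    have h3 : W (d + crossings ρ d + 1) = W (d + crossings ρ d) + 1 := by
      rw [hW, weightedContent_add_one, h2, subdivideShift_relabel]
    rw [crossings_add_one]
    split_ifs with h
    · have h4 : d + 1 + (crossings ρ d + 1) = d + crossings ρ d + 1 + 1 := by ring
      have h5 : relabel ρ + ((d + crossings ρ d + 1 : ℤ) : ZMod (e + 2)) = 1 := by
        rw [h, relabel_zero] at h2
        push_cast at h2 ⊢
        linear_combination h2
      rw [h4, hW, weightedContent_add_one, h5, subdivideShift_one, ← hW, h3]
      ring
    · have h4 : d + 1 + (crossings ρ d + 0) = d + crossings ρ d + 1 := by ring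
      rw [h4, h3]
      ring
  have key' : ∀ d : ℤ, W (d + 1 + crossings ρ (d + 1)) - ((d + 1 : ℤ) + ε * crossings ρ (d + 1))
      = W (d + crossings ρ d) - (d + ε * crossings ρ d) := by
    intro d
    rw [key, crossings_add_one]
    split_ifs <;> push_cast <;> ring
  rw [← sub_eq_zero]
  induction d with
  | zero => simp [hW, weightedContent_zero]
  | succ d ih =>
    rw [key']
    exact ih
  | pred d ih =>
    have := key' (-(d : ℤ) - 1)
    rw [sub_add_cancel] at this
    rw [← this]
    exact ih

/-- The last step leaves a relabelled vertex and so has length one. It gives the position of an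
added box, which stops at the new vertex before the edge of length `ε`. -/
theorem weightedContent_subdivideShift_extra (he : 1 ≤ e) (ε : ℝ) {ρ : ZMod (e + 1)} (d : ℤ) :
    weightedContent (subdivideShift ε (fun _ : ZMod (e + 1) => 1)) (relabel ρ)
      (d + (crossings ρ d + 1)) = d + 1 + ε * crossings ρ d := by
  rw [← add_assoc, weightedContent_add_one, relabel_add_content he, subdivideShift_relabel,
    weightedContent_subdivideShift he]
  ring

end Relabel

/-! ## The partition `lam⁺` -/

section Plus

variable {e : ℕ} {ρ : ZMod (e + 1)} {lam : YoungDiagram}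

/-- The box `a` moved right by `w`, respectively down by `-w`. -/
def place (w : ℤ) (a : ℕ × ℕ) : ℕ × ℕ := (a.1 + (-w).toNat, a.2 + w.toNat)

theorem content_place (w : ℤ) (a : ℕ × ℕ) : content (place w a) = content a + w := by
  simp only [content, place]
  push_cast
  omega

/-- The indices of the boxes replacing the nodes of `lam`: `(a, false)` is the box inherited from
the node `a`, and `(a, true)` is the box added for the `0`-node `a`. -/
def copies (ρ : ZMod (e + 1)) (lam : YoungDiagram) : Finset ((_ : ℕ × ℕ) × Bool) :=
  lam.cells.sigma fun a => if boxRes ρ a = 0 then Finset.univ else {false}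

/-- The box of `lam⁺` with a given index. -/
def newBox (ρ : ZMod (e + 1)) (p : (_ : ℕ × ℕ) × Bool) : ℕ × ℕ :=
  place (crossings ρ (content p.1) + if p.2 then 1 else 0) p.1

/-- The label of the box of `lam⁺` with a given index. -/
def newRes (ρ : ZMod (e + 1)) (p : (_ : ℕ × ℕ) × Bool) : ZMod (e + 2) :=
  if p.2 then 1 else relabel (boxRes ρ p.1)

theorem mem_copies {p : (_ : ℕ × ℕ) × Bool} :
    p ∈ copies ρ lam ↔ p.1 ∈ lam.cells ∧ (p.2 = true → boxRes ρ p.1 = 0) := by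
  rw [copies, Finset.mem_sigma]
  refine and_congr_right fun _ => ?_
  by_cases h : boxRes ρ p.1 = 0
  · simp [h]
  · simp [h]

theorem content_newBox (p : (_ : ℕ × ℕ) × Bool) :
    content (newBox ρ p)
      = content p.1 + crossings ρ (content p.1) + if p.2 then 1 else 0 := by
  rw [newBox, content_place, add_assoc]

theorem boxRes_newBox (he : 1 ≤ e) {p : (_ : ℕ × ℕ) × Bool} (hp : p ∈ copies ρ lam) :
    boxRes (relabel ρ) (newBox ρ p) = newRes ρ p := by
  obtain ⟨a, b⟩ := p
  have h := (mem_copies.1 hp).2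
  have h1 := relabel_add_content he ρ (content a)
  rw [boxRes_eq, content_newBox, newRes]
  cases b with
  | false => simpa [boxRes_eq] using h1
  | true =>
    have h0 : boxRes ρ a = 0 := h rfl
    rw [← boxRes_eq, h0, relabel_zero] at h1
    simp only [if_true]
    push_cast at h1 ⊢
    linear_combination h1

/-- The new contents on a later diagonal exceed all those on an earlier one, so the content of a box
recovers the old diagonal and whether the box was added. Boxes with both data equal undergo the same
translation. -/
theorem newBox_injOn : Set.InjOn (newBox ρ) (copies ρ lam : Set ((_ : ℕ × ℕ) × Bool)) := by
  rintro ⟨a, b⟩ hp ⟨a', b'⟩ hp' h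
  replace hp := (mem_copies.1 hp).2
  replace hp' := (mem_copies.1 hp').2
  have hc := congrArg content h
  rw [content_newBox, content_newBox] at hc
  have key : ∀ a a' : ℕ × ℕ, content a < content a' → content a' + crossings ρ (content a')
      ≥ content a + 1 + crossings ρ (content a) + if boxRes ρ a = 0 then 1 else 0 := by
    intro a a' h
    have h1 := crossings_mono ρ (show content a + 1 ≤ content a' by omega)
    rw [crossings_add_one, ← boxRes_eq] at h1
    omega
  have hle : ∀ (a : ℕ × ℕ) (b : Bool), (b = true → boxRes ρ a = 0) →
      0 ≤ (if b then (1 : ℤ) else 0) ∧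
        (if b then (1 : ℤ) else 0) ≤ if boxRes ρ a = 0 then 1 else 0 := by
    intro a b hb
    cases b with
    | false => simp; split_ifs <;> simp
    | true => simp [hb rfl]
  have hd : content a = content a' := by
    have hb := hle a b hp
    have hb' := hle a' b' hp'
    simp only at hc
    rcases lt_trichotomy (content a) (content a') with hlt | heq | hlt
    · have := key a a' hlt
      generalize (if boxRes ρ a = 0 then (1 : ℤ) else 0) = u at *
      generalize (if b = true then (1 : ℤ) else 0) = v at *
      generalize (if b' = true then (1 : ℤ) else 0) = v' at *
      omega
    · exact heq
    · have := key a' a hlt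
      generalize (if boxRes ρ a' = 0 then (1 : ℤ) else 0) = u at *
      generalize (if b = true then (1 : ℤ) else 0) = v at *
      generalize (if b' = true then (1 : ℤ) else 0) = v' at *
      omega
  simp only [hd] at hc
  have hb : b = b' := by
    cases b <;> cases b' <;> simp_all
  subst hb
  simp only [newBox, place, hd, Prod.mk.injEq] at h
  have : a = a' := Prod.ext (by omega) (by omega)
  rw [this]

/-- The left neighbour of an inherited box comes from the node to the left: its added box if that is
a `0`-node, its inherited one otherwise. Left of an added box is the inherited box of the same node
if the content is non-negative, and that of the diagonal predecessor otherwise. -/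
theorem newBox_left {r c : ℕ} {b : Bool} {r' c' : ℕ} (hp : ⟨(r, c), b⟩ ∈ copies ρ lam)
    (h : newBox ρ ⟨(r, c), b⟩ = (r', c' + 1)) : ∃ q ∈ copies ρ lam, newBox ρ q = (r', c') := by
  rw [mem_copies] at hp
  obtain ⟨hm, hb⟩ := hp
  simp only at hm hb
  have hlow : ∀ r₁ c₁, r₁ ≤ r → c₁ ≤ c → (r₁, c₁) ∈ lam.cells := fun r₁ c₁ h₁ h₂ =>
    lam.isLowerSet (show (r₁, c₁) ≤ (r, c) from ⟨h₁, h₂⟩) hm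
  simp only [newBox, place, content, Prod.mk.injEq] at h
  obtain ⟨h1, h2⟩ := h
  cases b with
  | false =>
    simp only [Bool.false_eq_true, if_false, add_zero] at h1 h2
    -- In the first column nothing moves right, so the new column would be `0`.
    have hc : 0 < c := by
      by_contra hc
      have := crossings_nonpos ρ (d := (c : ℤ) - r) (by omega)
      omega
    obtain ⟨c, rfl⟩ : ∃ c₁, c = c₁ + 1 := ⟨c - 1, by omega⟩
    have hs := crossings_add_one ρ ((c : ℤ) - r)
    have he : ((c + 1 : ℕ) : ℤ) - r = (c : ℤ) - r + 1 := by
      push_cast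
      ring
    have hres : ρ + (((c : ℤ) - r : ℤ) : ZMod (e + 1)) = boxRes ρ (r, c) := by
      rw [boxRes_eq]
      rfl
    rw [hres] at hs
    rw [he] at h1 h2
    have hsgn : ((c : ℤ) - r + 1 ≤ 0 ∧ crossings ρ ((c : ℤ) - r + 1) ≤ 0) ∨
        (0 ≤ (c : ℤ) - r ∧ 0 ≤ crossings ρ ((c : ℤ) - r)) := by
      rcases lt_or_ge ((c : ℤ) - r) 0 with h | h
      · exact Or.inl ⟨by omega, crossings_nonpos ρ (by omega)⟩
      · exact Or.inr ⟨h, crossings_nonneg ρ h⟩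
    by_cases h0 : boxRes ρ (r, c) = 0
    · rw [if_pos h0] at hs
      refine ⟨⟨(r, c), true⟩, mem_copies.2 ⟨hlow _ _ le_rfl (by omega), fun _ => h0⟩, ?_⟩
      simp only [newBox, place, content, Prod.mk.injEq, if_true]
      omega
    · rw [if_neg h0] at hs
      refine ⟨⟨(r, c), false⟩, mem_copies.2 ⟨hlow _ _ le_rfl (by omega), by simp⟩, ?_⟩
      simp only [newBox, place, content, Prod.mk.injEq, Bool.false_eq_true, if_false]
      omega
  | true =>
    simp only [if_true] at h1 h2
    have h0 := hb rfl
    have hres : ρ + (((c : ℤ) - r : ℤ) : ZMod (e + 1)) = boxRes ρ (r, c) := by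
      rw [boxRes_eq]
      rfl
    rcases lt_or_ge ((c : ℤ) - r) 0 with h | h
    · have hz := crossings_neg_of_res (ρ := ρ) h (hres.trans h0)
      obtain ⟨c, rfl⟩ : ∃ c₁, c = c₁ + 1 := ⟨c - 1, by omega⟩
      obtain ⟨r, rfl⟩ : ∃ r₁, r = r₁ + 1 := ⟨r - 1, by omega⟩
      have he : ((c + 1 : ℕ) : ℤ) - (r + 1 : ℕ) = (c : ℤ) - r := by
        push_cast
        ring
      rw [he] at h1 h2 hz
      refine ⟨⟨(r, c), false⟩, mem_copies.2 ⟨hlow _ _ (by omega) (by omega), by simp⟩, ?_⟩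
      simp only [newBox, place, content, Prod.mk.injEq, Bool.false_eq_true, if_false]
      omega
    · have hz := crossings_nonneg ρ h
      refine ⟨⟨(r, c), false⟩, mem_copies.2 ⟨hlow _ _ le_rfl le_rfl, by simp⟩, ?_⟩
      simp only [newBox, place, content, Prod.mk.injEq, Bool.false_eq_true, if_false]
      omega

/-- Transposed analogue of `newBox_left`; the roles of the two signs of the content are interchanged
at `0`-nodes. -/
theorem newBox_up {r c : ℕ} {b : Bool} {r' c' : ℕ} (hp : ⟨(r, c), b⟩ ∈ copies ρ lam)
    (h : newBox ρ ⟨(r, c), b⟩ = (r' + 1, c')) : ∃ q ∈ copies ρ lam, newBox ρ q = (r', c') := by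
  rw [mem_copies] at hp
  obtain ⟨hm, hb⟩ := hp
  simp only at hm hb
  have hlow : ∀ r₁ c₁, r₁ ≤ r → c₁ ≤ c → (r₁, c₁) ∈ lam.cells := fun r₁ c₁ h₁ h₂ =>
    lam.isLowerSet (show (r₁, c₁) ≤ (r, c) from ⟨h₁, h₂⟩) hm
  simp only [newBox, place, content, Prod.mk.injEq] at h
  obtain ⟨h1, h2⟩ := h
  have hres : ρ + (((c : ℤ) - r : ℤ) : ZMod (e + 1)) = boxRes ρ (r, c) := by
    rw [boxRes_eq]
    rfl
  have hs := crossings_add_one ρ ((c : ℤ) - r)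
  rw [hres] at hs
  have hsgn : ((c : ℤ) - r + 1 ≤ 0 ∧ crossings ρ ((c : ℤ) - r + 1) ≤ 0) ∨
      (0 ≤ (c : ℤ) - r ∧ 0 ≤ crossings ρ ((c : ℤ) - r)) := by
    rcases lt_or_ge ((c : ℤ) - r) 0 with h | h
    · exact Or.inl ⟨by omega, crossings_nonpos ρ (by omega)⟩
    · exact Or.inr ⟨h, crossings_nonneg ρ h⟩
  by_cases h0 : boxRes ρ (r, c) = 0
  · rw [if_pos h0] at hs
    cases b with
    | false =>
      simp only [Bool.false_eq_true, if_false, add_zero] at h1 h2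
      rcases lt_or_ge ((c : ℤ) - r) 0 with h | h
      · refine ⟨⟨(r, c), true⟩, mem_copies.2 ⟨hlow _ _ le_rfl le_rfl, fun _ => h0⟩, ?_⟩
        simp only [newBox, place, content, Prod.mk.injEq, if_true]
        omega
      · obtain ⟨r, rfl⟩ : ∃ r₁, r = r₁ + 1 := ⟨r - 1, by omega⟩
        obtain ⟨c, rfl⟩ : ∃ c₁, c = c₁ + 1 := ⟨c - 1, by omega⟩
        have he : ((c + 1 : ℕ) : ℤ) - (r + 1 : ℕ) = (c : ℤ) - r := by
          push_cast
          ring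
        rw [he] at h1 h2 hs hsgn
        have h0' : boxRes ρ (r, c) = 0 := by
          rw [boxRes_eq] at h0 ⊢
          rw [content, he] at h0
          exact h0
        refine ⟨⟨(r, c), true⟩, mem_copies.2 ⟨hlow _ _ (by omega) (by omega), fun _ => h0'⟩, ?_⟩
        simp only [newBox, place, content, Prod.mk.injEq, if_true]
        omega
    | true =>
      simp only [if_true] at h1 h2
      obtain ⟨r, rfl⟩ : ∃ r₁, r = r₁ + 1 := ⟨r - 1, by omega⟩
      have he : (c : ℤ) - (r + 1 : ℕ) + 1 = (c : ℤ) - r := by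
        push_cast
        ring
      rw [he] at hs hsgn
      refine ⟨⟨(r, c), false⟩, mem_copies.2 ⟨hlow _ _ (by omega) le_rfl, by simp⟩, ?_⟩
      simp only [newBox, place, content, Prod.mk.injEq, Bool.false_eq_true, if_false]
      omega
  · rw [if_neg h0] at hs
    cases b with
    | true => exact absurd (hb rfl) h0
    | false =>
      simp only [Bool.false_eq_true, if_false, add_zero] at h1 h2
      obtain ⟨r, rfl⟩ : ∃ r₁, r = r₁ + 1 := ⟨r - 1, by omega⟩
      have he : (c : ℤ) - (r + 1 : ℕ) + 1 = (c : ℤ) - r := by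
        push_cast
        ring
      rw [he] at hs hsgn
      refine ⟨⟨(r, c), false⟩, mem_copies.2 ⟨hlow _ _ (by omega) le_rfl, by simp⟩, ?_⟩
      simp only [newBox, place, content, Prod.mk.injEq, Bool.false_eq_true, if_false]
      omega

theorem isLowerSet_of_steps {S : Set (ℕ × ℕ)} (hl : ∀ r c, (r, c + 1) ∈ S → (r, c) ∈ S)
    (hu : ∀ r c, (r + 1, c) ∈ S → (r, c) ∈ S) : IsLowerSet S := by
  rintro ⟨r, c⟩ ⟨r', c'⟩ ⟨h1, h2⟩ h
  simp only at h1 h2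
  obtain ⟨k, rfl⟩ := Nat.exists_eq_add_of_le h1
  obtain ⟨k', rfl⟩ := Nat.exists_eq_add_of_le h2
  have h3 : (r' + k, c') ∈ S := by
    clear h1 h2
    induction k' with
    | zero => exact h
    | succ k' ih => exact ih (hl _ _ h)
  clear h h1 h2
  induction k with
  | zero => exact h3
  | succ k ih => exact ih (hu _ _ h3)

/-- The partition `lam⁺`. -/
def plusDiagram (ρ : ZMod (e + 1)) (lam : YoungDiagram) : YoungDiagram where
  cells := (copies ρ lam).image (newBox ρ)
  isLowerSet := by
    apply isLowerSet_of_steps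
    · intro r c h
      simp only [Finset.coe_image, Set.mem_image, Finset.mem_coe] at h ⊢
      obtain ⟨⟨⟨r₁, c₁⟩, b⟩, hp, h⟩ := h
      exact newBox_left hp h
    · intro r c h
      simp only [Finset.coe_image, Set.mem_image, Finset.mem_coe] at h ⊢
      obtain ⟨⟨⟨r₁, c₁⟩, b⟩, hp, h⟩ := h
      exact newBox_up hp h

theorem plusDiagram_cells_val :
    (plusDiagram ρ lam).cells.val = (copies ρ lam).val.map (newBox ρ) :=
  Finset.image_val_of_injOn newBox_injOn

theorem filledBoxes_plusDiagram (he : 1 ≤ e) :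
    filledBoxes (relabel ρ) (plusDiagram ρ lam)
      = (copies ρ lam).val.map fun p => (newBox ρ p, newRes ρ p) := by
  rw [filledBoxes, plusDiagram_cells_val, Multiset.map_map]
  refine Multiset.map_congr rfl fun p hp => ?_
  simp only [Function.comp, boxRes_newBox he hp]

/-- Within a row, nodes correspond to contents, and `onStrip_zero_iff` selects exactly the contents
from `0` to that of `a` counted by `crossings`. -/
theorem pushRight_eq (he : 1 ≤ e) {a : ℕ × ℕ} (ha : a ∈ lam.cells) :
    pushRight ρ lam a = (crossings ρ (content a)).toNat := by
  classical
  have hlow : ∀ c, c < a.2 → (a.1, c) ∈ lam.cells := fun c h =>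
    lam.isLowerSet (show (a.1, c) ≤ a from ⟨le_rfl, h.le⟩) ha
  rcases le_or_gt 0 (content a) with h | h
  · have h1 : crossings ρ (content a)
        = ((Finset.Ico 0 (content a)).filter fun k : ℤ => ρ + (k : ZMod (e + 1)) = 0).card := by
      simp [crossings, Finset.Ico_eq_empty_of_le h]
    rw [h1, Int.toNat_natCast, pushRight]
    simp only [content] at h
    refine Finset.card_bij (fun b _ => content b) ?_ ?_ ?_
    · intro b hb
      rw [Finset.mem_filter] at hb ⊢
      obtain ⟨hm, hb1, hb2, hb0, hs⟩ := hb
      rw [onStrip_zero_iff he hm hb0] at hs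
      refine ⟨Finset.mem_Ico.2 ⟨hs, ?_⟩, ?_⟩
      · simp only [content]
        omega
      · rw [← boxRes_eq, hb0]
    · intro b hb b' hb' hbb
      rw [Finset.mem_filter] at hb hb'
      simp only [content] at hbb
      exact Prod.ext (by omega) (by omega)
    · intro k hk
      rw [Finset.mem_filter, Finset.mem_Ico] at hk
      obtain ⟨⟨hk0, hk1⟩, hk2⟩ := hk
      simp only [content] at hk1
      have hc : content (a.1, (a.1 + k).toNat) = k := by
        simp only [content]
        omega
      have hm := hlow (a.1 + k).toNat (by omega)
      have hr : boxRes ρ (a.1, (a.1 + k).toNat) = 0 := by rw [boxRes_eq, hc, hk2]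
      refine ⟨(a.1, (a.1 + k).toNat), ?_, hc⟩
      rw [Finset.mem_filter]
      refine ⟨hm, rfl, ?_, hr, ?_⟩
      · simp only
        omega
      · rw [onStrip_zero_iff he hm hr, hc]
        exact hk0
  · have h1 := crossings_nonpos ρ h.le
    rw [Int.toNat_of_nonpos h1, pushRight, Finset.card_eq_zero, Finset.filter_eq_empty_iff]
    rintro b hm ⟨hb1, hb2, hb0, hs⟩
    rw [onStrip_zero_iff he hm hb0] at hs
    simp only [content] at h hs
    omega

/-- Only nodes strictly above `a` are counted, hence `content a + 1`: the contribution of `a` itself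
is left out. -/
theorem pushDown_eq (he : 1 ≤ e) {a : ℕ × ℕ} (ha : a ∈ lam.cells) :
    pushDown ρ lam a = (-crossings ρ (content a + 1)).toNat := by
  classical
  have hlow : ∀ r, r < a.1 → (r, a.2) ∈ lam.cells := fun c h =>
    lam.isLowerSet (show (c, a.2) ≤ a from ⟨h.le, le_rfl⟩) ha
  rcases lt_or_ge (content a) 0 with h | h
  · have h1 : -crossings ρ (content a + 1)
        = ((Finset.Ico (content a + 1) 0).filter
            fun k : ℤ => ρ + (k : ZMod (e + 1)) = 0).card := by
      simp [crossings, Finset.Ico_eq_empty_of_le (show content a + 1 ≤ 0 by omega)]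
    rw [h1, Int.toNat_natCast, pushDown]
    simp only [content] at h
    refine Finset.card_bij (fun b _ => content b) ?_ ?_ ?_
    · intro b hb
      rw [Finset.mem_filter] at hb ⊢
      obtain ⟨hm, hb1, hb2, hb0, hs⟩ := hb
      rw [onStrip_one_iff he hm hb0] at hs
      refine ⟨Finset.mem_Ico.2 ⟨?_, hs⟩, ?_⟩
      · simp only [content]
        omega
      · rw [← boxRes_eq, hb0]
    · intro b hb b' hb' hbb
      rw [Finset.mem_filter] at hb hb'
      simp only [content] at hbb
      exact Prod.ext (by omega) (by omega)
    · intro k hk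
      rw [Finset.mem_filter, Finset.mem_Ico] at hk
      obtain ⟨⟨hk0, hk1⟩, hk2⟩ := hk
      simp only [content] at hk0
      have hc : content ((a.2 - k).toNat, a.2) = k := by
        simp only [content]
        omega
      have hm := hlow (a.2 - k).toNat (by omega)
      have hr : boxRes ρ ((a.2 - k).toNat, a.2) = 0 := by rw [boxRes_eq, hc, hk2]
      refine ⟨((a.2 - k).toNat, a.2), ?_, hc⟩
      rw [Finset.mem_filter]
      refine ⟨hm, rfl, ?_, hr, ?_⟩
      · simp only
        omega
      · rw [onStrip_one_iff he hm hr, hc]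
        exact hk1
  · have h1 := crossings_nonneg ρ (d := content a + 1) (by omega)
    rw [Int.toNat_of_nonpos (by omega), pushDown, Finset.card_eq_zero,
      Finset.filter_eq_empty_iff]
    rintro b hm ⟨hb1, hb2, hb0, hs⟩
    rw [onStrip_one_iff he hm hb0] at hs
    simp only [content] at h hs
    omega

theorem replaceBox_eq (he : 1 ≤ e) {a : ℕ × ℕ} (ha : a ∈ lam.cells) :
    replaceBox ρ lam a = (if boxRes ρ a = 0 then Finset.univ else {false}).val.map
      fun b => (newBox ρ ⟨a, b⟩, newRes ρ ⟨a, b⟩) := by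
  have huniv : (Finset.univ : Finset Bool).val = {true, false} := rfl
  have hs := crossings_add_one ρ (content a)
  rw [← boxRes_eq] at hs
  rw [replaceBox, pushRight_eq he ha, pushDown_eq he ha]
  by_cases h0 : boxRes ρ a = 0
  · rw [if_pos h0] at hs
    rcases lt_or_ge (content a) 0 with h | h
    · have h1 : ¬ OnStrip ρ lam 0 a := by
        rw [onStrip_zero_iff he ha h0]
        omega
      have h2 : OnStrip ρ lam 1 a := (onStrip_one_iff he ha h0).2 h
      have hz := crossings_nonpos ρ (d := content a + 1) (by omega)
      have e1 : (a.1 + (-crossings ρ (content a + 1)).toNat, a.2 + (crossings ρ (content a)).toNat)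
          = newBox ρ ⟨a, true⟩ := by
        simp only [newBox, place, if_true, Prod.mk.injEq]
        omega
      -- The inherited `0` is the lower box of the vertical pair; its extra row is the contribution
      -- of `a` that `pushDown` omits.
      have e2 : (a.1 + (-crossings ρ (content a + 1)).toNat + 1,
          a.2 + (crossings ρ (content a)).toNat) = newBox ρ ⟨a, false⟩ := by
        simp only [newBox, place, Bool.false_eq_true, if_false, Prod.mk.injEq]
        omega
      simp only [h0, h1, h2, and_true, and_false, if_true, if_false, e1, e2, huniv]
      simp [newRes, h0]
    · have h1 : OnStrip ρ lam 0 a := (onStrip_zero_iff he ha h0).2 h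
      have hz := crossings_nonneg ρ h
      have e1 : (a.1 + (-crossings ρ (content a + 1)).toNat, a.2 + (crossings ρ (content a)).toNat)
          = newBox ρ ⟨a, false⟩ := by
        simp only [newBox, place, Bool.false_eq_true, if_false, Prod.mk.injEq]
        omega
      have e2 : (a.1 + (-crossings ρ (content a + 1)).toNat,
          a.2 + (crossings ρ (content a)).toNat + 1) = newBox ρ ⟨a, true⟩ := by
        simp only [newBox, place, if_true, Prod.mk.injEq]
        omega
      simp only [h0, h1, and_true, if_true, e1, e2, huniv]
      simp only [newRes, h0, relabel_zero, Multiset.insert_eq_cons, Multiset.map_cons,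
        Multiset.map_singleton, if_true, Bool.false_eq_true, if_false]
      exact Multiset.pair_comm _ _
  · rw [if_neg h0] at hs
    have e1 : (a.1 + (-crossings ρ (content a + 1)).toNat, a.2 + (crossings ρ (content a)).toNat)
        = newBox ρ ⟨a, false⟩ := by
      simp only [newBox, place, Bool.false_eq_true, if_false, Prod.mk.injEq]
      omega
    simp only [h0, false_and, if_false, e1]
    simp [newRes]

theorem plusBoxes_eq (he : 1 ≤ e) :
    plusBoxes ρ lam = (copies ρ lam).val.map fun p => (newBox ρ p, newRes ρ p) := by
  have hval : (copies ρ lam).val = lam.cells.val.bind fun a =>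
      (if boxRes ρ a = 0 then Finset.univ else {false}).val.map (Sigma.mk a) := rfl
  rw [plusBoxes, hval, Multiset.map_bind]
  refine Multiset.bind_congr fun a ha => ?_
  rw [replaceBox_eq he ha, Multiset.map_map]
  rfl

theorem isPlus_plusDiagram (he : 1 ≤ e) {ℓ : ℕ} (ρ : Fin ℓ → ZMod (e + 1))
    (lam : Fin ℓ → YoungDiagram) : IsPlus ρ lam fun m => plusDiagram (ρ m) (lam m) := fun m => by
  rw [filledBoxes_plusDiagram he, plusBoxes_eq he]

theorem newBox_sum (p : (_ : ℕ × ℕ) × Bool) :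
    (((newBox ρ p).1 : ℤ) + (newBox ρ p).2)
      = p.1.1 + p.1.2 + |crossings ρ (content p.1) + if p.2 then 1 else 0| := by
  simp only [newBox, place]
  set w := crossings ρ (content p.1) + if p.2 then 1 else 0
  rcases abs_cases w with h | h <;> push_cast <;> omega

end Plus

theorem _root_.YoungDiagram.add_lt_card (lam : YoungDiagram) {a : ℕ × ℕ} (ha : a ∈ lam.cells) :
    a.1 + a.2 < lam.cells.card := by
  have : (Finset.range (a.1 + a.2 + 1)).card ≤ lam.cells.card := by
    -- The row of `a` up to `a` and the part of the first column above that row together have `a.1 +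
    -- a.2 + 1` cells.
    refine Finset.card_le_card_of_injOn
      (fun k => if k ≤ a.2 then (a.1, k) else (k - a.2 - 1, 0)) ?_ ?_
    · intro k hk
      have hk := Finset.mem_range.1 (Finset.mem_coe.1 hk)
      refine lam.isLowerSet (a := a) ?_ ha
      simp only
      split_ifs with h
      · exact ⟨le_rfl, h⟩
      · exact ⟨show k - a.2 - 1 ≤ a.1 by omega, Nat.zero_le _⟩
    · intro k hk k' hk' h
      have hk := Finset.mem_range.1 (Finset.mem_coe.1 hk)
      have hk' := Finset.mem_range.1 (Finset.mem_coe.1 hk')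
      simp only at h
      split_ifs at h <;> simp only [Prod.mk.injEq] at h <;> omega
  rw [Finset.card_range] at this
  omega

/-! ## Separation of diagonals and components -/

section Separation

variable {ℓ : ℕ}

theorem card_le_size (lam : Fin ℓ → YoungDiagram) (m : Fin ℓ) :
    (lam m).cells.card ≤ size lam :=
  Finset.single_le_sum (f := fun m => (lam m).cells.card) (fun _ _ => Nat.zero_le _)
    (Finset.mem_univ m)

theorem card_add_card_le_size (lam : Fin ℓ → YoungDiagram) {m m' : Fin ℓ} (h : m ≠ m') :
    (lam m).cells.card + (lam m').cells.card ≤ size lam := by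
  rw [← Finset.sum_pair (f := fun m => (lam m).cells.card) h]
  exact Finset.sum_le_sum_of_subset (Finset.subset_univ _)

theorem abs_content_lt {lam : Fin ℓ → YoungDiagram} {m : Fin ℓ} {a : ℕ × ℕ}
    (ha : a ∈ (lam m).cells) : |content a| < (lam m).cells.card := by
  have := (lam m).add_lt_card ha
  simp only [content]
  rw [abs_lt]
  constructor <;> omega

theorem IsAsymptotic.mul_le {n : ℕ} {κ : Fin ℓ → ℤ} (h : IsAsymptotic n κ) (k : ℕ) :
    ∀ m m' : Fin ℓ, (m' : ℕ) = m + k → κ m + k * (n : ℤ) ≤ κ m' := by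
  induction k with
  | zero =>
    intro m m' hm
    have : m = m' := Fin.ext (by omega)
    simp [this]
  | succ k ih =>
    intro m m' hm
    have h1 := ih m ⟨m + k, by omega⟩ rfl
    have h2 := h.2 ⟨m + k, by omega⟩ m' (by rw [Fin.lt_def]; simp only; omega)
    push_cast
    linarith

/-- The position of the diagonal of content `D` of the `m`-th component, without the shift that
depends on the row and the column. -/
def base (κ : Fin ℓ → ℤ) (M : ℝ) (m : Fin ℓ) (D : ℤ) : ℝ := (κ m : ℝ) + D - ((m : ℝ) + 1) / M

/-- Passing `k + 1` components gains `(k + 1) n`. The contents use at most `n - 1` of it and the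
fractional terms `(k + 1) / M`, where `k / M ≤ k n`. -/
theorem base_add_le_of_lt {n : ℕ} {κ : Fin ℓ → ℤ} (h : IsAsymptotic n κ) {m m' : Fin ℓ}
    (hm : m < m') {D D' : ℤ} (hD : D - D' ≤ n - 1) (hn : 1 ≤ n) {M : ℝ} (hM : 1 ≤ M) :
    base κ M m D + (1 - 1 / M) ≤ base κ M m' D' := by
  obtain ⟨k, hk⟩ := Nat.exists_eq_add_of_lt (Fin.lt_def.1 hm)
  have h1 := h.mul_le (k + 1) m m' (by omega)
  have h2 : (κ m : ℝ) + ((k + 1 : ℕ) : ℝ) * (n : ℝ) ≤ κ m' := by exact_mod_cast h1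
  have h3 : (D : ℝ) - D' ≤ n - 1 := by exact_mod_cast hD
  have h4 : ((m' : ℕ) : ℝ) = (m : ℕ) + k + 1 := by exact_mod_cast hk
  have h5 : (1 : ℝ) ≤ n := by exact_mod_cast hn
  have h6 : (k : ℝ) / M ≤ k * n := by
    calc (k : ℝ) / M ≤ k := div_le_self (Nat.cast_nonneg _) hM
      _ ≤ k * n := le_mul_of_one_le_right (Nat.cast_nonneg _) h5
  have h7 : (((m : ℕ) : ℝ) + k + 1 + 1) / M = (((m : ℕ) : ℝ) + 1) / M + k / M + 1 / M := by ring
  rw [base, base, h4, h7]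
  push_cast at h2
  linarith

/-- The quantifier over `M` stands inside each alternative: the order is the same for the levels of
both diagrams. -/
theorem base_dichotomy {n : ℕ} {κ : Fin ℓ → ℤ} (h : IsAsymptotic n κ) (hn : 1 ≤ n)
    {m m' : Fin ℓ} {D D' : ℤ} (hne : ¬ (m = m' ∧ D = D'))
    (hD : m ≠ m' → |D - D'| ≤ n - 1) :
    (∀ M : ℝ, 1 ≤ M → base κ M m D + (1 - 1 / M) ≤ base κ M m' D') ∨
      (∀ M : ℝ, 1 ≤ M → base κ M m' D' + (1 - 1 / M) ≤ base κ M m D) := by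
  rcases lt_trichotomy m m' with hm | rfl | hm
  · have := abs_le.1 (hD hm.ne)
    exact Or.inl fun M hM => base_add_le_of_lt h hm this.2 hn hM
  · have aux : ∀ D D' : ℤ, D < D' → ∀ M : ℝ, 1 ≤ M →
        base κ M m D + (1 - 1 / M) ≤ base κ M m D' := by
      intro D D' hDD M hM
      have h1 : (D : ℝ) + 1 ≤ D' := by exact_mod_cast hDD
      have h2 : 0 ≤ 1 / M := by positivity
      rw [base, base]
      linarith
    rcases lt_trichotomy D D' with hDD | hDD | hDD
    · exact Or.inl (aux D D' hDD)
    · exact absurd ⟨rfl, hDD⟩ hne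
    · exact Or.inr (aux D' D hDD)
  · have := abs_le.1 (hD hm.ne')
    exact Or.inr fun M hM => base_add_le_of_lt h hm (by omega) hn hM

variable {e : ℕ} {lam : Fin ℓ → YoungDiagram} {η : ℝ}

theorem affineLevel_ge (he : 1 ≤ e) {m : Fin ℓ} {a : ℕ × ℕ} (ha : a ∈ (lam m).cells) :
    3 ≤ affineLevel (e + 1) lam ∧ 1 ≤ size lam ∧ ℓ + 2 * size lam ≤ affineLevel (e + 1) lam := by
  have h1 : 0 < (lam m).cells.card := Finset.card_pos.2 ⟨a, ha⟩
  have h2 := card_le_size lam m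
  have h3 : 0 < ℓ := m.pos
  have h4 : size lam * 2 ≤ size lam * (e + 1) := Nat.mul_le_mul_left _ (by omega)
  rw [affineLevel]
  omega

theorem size_mul_lt_div {N : ℕ} {σ : ZMod N → ℝ} (h : IsSpacing σ lam η)
    (hL : 0 < affineLevel N lam) (i : ZMod N) :
    size lam * η < σ i / (2 * affineLevel N lam) := by
  have h1 := h.2 i
  have h2 : (0 : ℝ) < affineLevel N lam := by exact_mod_cast hL
  rw [lt_div_iff₀ (by positivity)]
  linarith

end Separation

/-! ## Close tuples of the idempotent of a partition -/

section Tuples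

variable {e ℓ : ℕ} {lam : Fin ℓ → YoungDiagram} {ρ : Fin ℓ → ZMod (e + 1)} {κ : Fin ℓ → ℤ}
  {η δ : ℝ}

/-- The position of the marked string of a node: of the solid string for a `1`-node and of the
ghost string for a `0`-node. -/
def markedPos (κ : Fin ℓ → ℤ) (ρ : Fin ℓ → ZMod (e + 1)) (η : ℝ) (lam : Fin ℓ → YoungDiagram)
    (m : Fin ℓ) (a : ℕ × ℕ) : ℝ :=
  base κ (affineLevel (e + 1) lam) m (stripContent (ρ m) a + 1) - ((a.1 : ℝ) + a.2 + 2) * η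

theorem coord_one (κ : Fin ℓ → ℤ) (ρ : Fin ℓ → ZMod (e + 1)) (η : ℝ) (lam : Fin ℓ → YoungDiagram)
    (m : Fin ℓ) (a : ℕ × ℕ) : coord (fun _ => 1) κ ρ η lam m a
      = base κ (affineLevel (e + 1) lam) m (content a) - ((a.1 : ℝ) + a.2 + 2) * η := by
  rw [coord, weightedContent_one, base, content]
  ring

theorem base_add_one (M : ℝ) (m : Fin ℓ) (D : ℤ) : base κ M m (D + 1) = base κ M m D + 1 := by
  rw [base, base]
  push_cast
  ring

theorem markedPos_of_zero {m : Fin ℓ} {a : ℕ × ℕ} (h : boxRes (ρ m) a = 0) :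
    markedPos κ ρ η lam m a = coord (fun _ => 1) κ ρ η lam m a + 1 := by
  rw [coord_one, markedPos, stripContent, if_pos h, base_add_one]
  ring

theorem markedPos_of_one (he : 1 ≤ e) {m : Fin ℓ} {a : ℕ × ℕ} (h : boxRes (ρ m) a = 1) :
    markedPos κ ρ η lam m a = coord (fun _ => 1) κ ρ η lam m a := by
  rw [coord_one, markedPos, stripContent, if_neg (by rw [h]; exact (zero_ne_one_zmod he).symm),
    sub_add_cancel]

theorem mem_solid {N : ℕ} {σ : ZMod N → ℝ} {ρ : Fin ℓ → ZMod N} {p : ℝ × ZMod N} :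
    p ∈ (partitionIdempotent σ κ ρ η lam).solid ↔
      ∃ m, ∃ a ∈ (lam m).cells, (coord σ κ ρ η lam m a, boxRes (ρ m) a) = p := by
  simp [partitionIdempotent, Multiset.mem_sum]

theorem mem_marked (he : 1 ≤ e) {p : ℝ × ZMod (e + 1)} :
    p ∈ marked (partitionIdempotent (fun _ => 1) κ ρ η lam) ↔
      ∃ m, ∃ a ∈ (lam m).cells, (boxRes (ρ m) a = 0 ∨ boxRes (ρ m) a = 1) ∧
        (markedPos κ ρ η lam m a, boxRes (ρ m) a) = p := by
  rw [marked, Multiset.mem_add, Multiset.mem_filter, Multiset.mem_map, mem_solid]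
  constructor
  · rintro (⟨⟨m, a, ha, rfl⟩, h1⟩ | ⟨q, hq, rfl⟩)
    · exact ⟨m, a, ha, Or.inr h1, by rw [markedPos_of_one he h1]⟩
    · rw [Multiset.mem_filter, mem_solid] at hq
      obtain ⟨⟨m, a, ha, rfl⟩, h0⟩ := hq
      have h0' : boxRes (ρ m) a = 0 := h0
      exact ⟨m, a, ha, Or.inl h0, by rw [markedPos_of_zero h0', h0']; rfl⟩
  · rintro ⟨m, a, ha, h | h, rfl⟩
    · refine Or.inr ⟨(coord (fun _ => 1) κ ρ η lam m a, boxRes (ρ m) a), ?_, ?_⟩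
      · rw [Multiset.mem_filter, mem_solid]
        exact ⟨⟨m, a, ha, rfl⟩, h⟩
      · rw [markedPos_of_zero h, h]
        rfl
    · exact Or.inl ⟨⟨m, a, ha, by rw [markedPos_of_one he h]⟩, h⟩

/-- Otherwise the bases differ by at least `1 - 1 / M ≥ 2/3`, while the `η`-terms differ by less
than `1/6`. -/
theorem same_strip_of_close (he : 1 ≤ e) (hκ : IsAsymptotic (size lam) κ)
    (hη : IsSpacing (fun _ : ZMod (e + 1) => 1) lam η) {m m' : Fin ℓ} {a a' : ℕ × ℕ}
    (ha : a ∈ (lam m).cells) (ha' : a' ∈ (lam m').cells)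
    (h1 : markedPos κ ρ η lam m a - markedPos κ ρ η lam m' a' < 1 / 2)
    (h2 : markedPos κ ρ η lam m' a' - markedPos κ ρ η lam m a < 1 / 2) :
    m = m' ∧ stripContent (ρ m) a = stripContent (ρ m') a' := by
  obtain ⟨hL, hn, -⟩ := affineLevel_ge he ha
  by_contra hne
  have hdich := base_dichotomy hκ hn (m := m) (m' := m') (D := stripContent (ρ m) a + 1)
    (D' := stripContent (ρ m') a' + 1) (by rw [add_left_inj]; exact hne) (fun hm => by
      have h1 := abs_lt.1 (abs_content_lt ha)
      have h2 := abs_lt.1 (abs_content_lt ha')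
      have h3 := card_add_card_le_size lam hm
      rw [abs_le]
      simp only [stripContent]
      split_ifs <;> constructor <;> omega)
  have hL' : (3 : ℝ) ≤ affineLevel (e + 1) lam := by exact_mod_cast hL
  set M : ℝ := ((affineLevel (e + 1) lam : ℕ) : ℝ) with hM
  have h4 : 1 / M ≤ 1 / 3 := one_div_le_one_div_of_le (by norm_num) hL'
  have h5 := size_mul_lt_div hη (by omega) 0
  rw [← hM] at h5
  have h6 : 1 / (2 * M) = 1 / M / 2 := by ring
  have hs : ∀ m : Fin ℓ, ∀ a ∈ (lam m).cells,
      0 < ((a.1 : ℝ) + a.2 + 1) * η ∧ ((a.1 : ℝ) + a.2 + 1) * η ≤ size lam * η := by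
    intro m a ha
    have h7 := (lam m).add_lt_card ha
    have h8 := card_le_size lam m
    have h9 : (a.1 : ℝ) + a.2 + 1 ≤ size lam := by exact_mod_cast (by omega)
    exact ⟨mul_pos (by positivity) hη.1, mul_le_mul_of_nonneg_right h9 hη.1.le⟩
  have hs1 := hs m a ha
  have hs2 := hs m' a' ha'
  simp only [markedPos] at h1 h2
  rcases hdich with hd | hd
  · have := hd M (by linarith)
    linarith
  · have := hd M (by linarith)
    linarith

theorem IsCloseTuple.length_le {N : ℕ} {Y : IdempotentDiagram N ℓ} {l : List (ℝ × ZMod N)}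
    (h : IsCloseTuple δ Y l) : l.length ≤ Multiset.card (marked Y) := by
  have hp : l.Pairwise fun a b => a.1 < b.1 := by
    have hc : l.IsChain fun a b => a.1 < b.1 := h.2.2.imp fun a b hab => hab.1
    have : IsTrans (ℝ × ZMod N) fun a b => a.1 < b.1 := ⟨fun a b c => lt_trans⟩
    exact List.isChain_iff_pairwise.1 hc
  have hn : l.Nodup := hp.imp fun hab => by
    rintro rfl
    exact lt_irrefl _ hab
  have : (l : Multiset (ℝ × ZMod N)) ≤ marked Y :=
    (Multiset.le_iff_subset (Multiset.coe_nodup.2 hn)).2 fun a ha =>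
      h.2.1 a (Multiset.mem_coe.1 ha)
  simpa using Multiset.card_le_card this

theorem exists_maximalCloseTuple {N : ℕ} {Y : IdempotentDiagram N ℓ} {p : ℝ × ZMod N}
    (hp : p ∈ marked Y) : ∃ l, IsMaximalCloseTuple δ Y l ∧ p ∈ l := by
  obtain ⟨l, hl, hal, hm⟩ := exists_maximal_infix (IsCloseTuple δ Y) _
    (fun l h => h.length_le) [p] ⟨by simp, by simpa using hp, by simp⟩
  exact ⟨l, ⟨hl, hm⟩, hal.subset (by simp)⟩

theorem IsMaximalCloseTuple.not_step {N : ℕ} {Y : IdempotentDiagram N ℓ}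
    {l : List (ℝ × ZMod N)} {b q : ℝ × ZMod N} (h : IsMaximalCloseTuple δ Y l)
    (hb : l.getLast? = some b) (hq : q ∈ marked Y) :
    ¬ (b.1 < q.1 ∧ q.1 - b.1 < δ ∧ b.2 ≠ q.2 ∧ ∀ c ∈ marked Y, ¬ (b.1 < c.1 ∧ c.1 < q.1)) := by
  intro hbq
  have h1 : IsCloseTuple δ Y (l ++ [q]) := by
    refine ⟨by simp, ?_, ?_⟩
    · intro x hx
      rcases List.mem_append.1 hx with hx | hx
      · exact h.1.2.1 x hx
      · rw [List.mem_singleton.1 hx]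
        exact hq
    · refine List.isChain_append.2 ⟨h.1.2.2, by simp, ?_⟩
      intro x hx y hy
      rw [hb] at hx
      obtain rfl : b = x := by simpa using hx
      obtain rfl : q = y := by simpa using hy
      exact hbq
  have := congrArg List.length (h.2 _ h1 (List.prefix_append l [q]).isInfix)
  simp at this

/-- The marked string of the preceding node of the strip lies `η < δ` to the right with no marked
string in between, so it would extend the tuple. A close tuple read from right to left follows a
strip. -/
theorem IsMaximalCloseTuple.not_adjacent (he : 1 ≤ e) (hκ : IsAsymptotic (size lam) κ)
    (hη : IsSpacing (fun _ : ZMod (e + 1) => 1) lam η) (hδ : η < δ) (hδ' : δ ≤ 1 / 2)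
    {l : List (ℝ × ZMod (e + 1))} {m : Fin ℓ} {a a' : ℕ × ℕ}
    (h : IsMaximalCloseTuple δ (partitionIdempotent (fun _ => 1) κ ρ η lam) l)
    (hb : l.getLast? = some (markedPos κ ρ η lam m a, boxRes (ρ m) a))
    (ha : a ∈ (lam m).cells) (ha' : a' ∈ (lam m).cells)
    (hr : boxRes (ρ m) a = 0 ∨ boxRes (ρ m) a = 1)
    (hr' : boxRes (ρ m) a' = 0 ∨ boxRes (ρ m) a' = 1) : ¬ StripStep (ρ m) a' a := by
  intro hstep
  have hsc := stripContent_eq_of_step he hstep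
  have hsum : a.1 + a.2 = a'.1 + a'.2 + 1 := by
    rcases hstep with ⟨-, rfl⟩ | ⟨-, rfl⟩ <;> simp only <;> omega
  have hsum' : (a.1 : ℝ) + a.2 = a'.1 + a'.2 + 1 := by exact_mod_cast hsum
  have hpos : markedPos κ ρ η lam m a' = markedPos κ ρ η lam m a + η := by
    rw [markedPos, markedPos, hsc, hsum']
    ring
  have h01 := zero_ne_one_zmod he
  have hne : boxRes (ρ m) a ≠ boxRes (ρ m) a' := by
    rcases hstep with ⟨h0, rfl⟩ | ⟨h0, rfl⟩
    · have : boxRes (ρ m) (a'.1, a'.2 + 1) = 1 := by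
        simp only [boxRes] at h0 ⊢
        push_cast
        linear_combination h0
      rw [this, h0]
      exact h01.symm
    · have : boxRes (ρ m) (a'.1 + 1, a'.2) = 0 := by
        simp only [boxRes] at h0 ⊢
        push_cast
        linear_combination h0
      rw [this, h0]
      exact h01
  refine h.not_step hb (q := (markedPos κ ρ η lam m a', boxRes (ρ m) a'))
    ((mem_marked he).2 ⟨m, a', ha', hr', rfl⟩) ⟨?_, ?_, hne, ?_⟩
  · simp only [hpos]
    linarith [hη.1]
  · simp only [hpos]
    linarith
  · rintro c hc ⟨hc1, hc2⟩
    obtain ⟨m₁, a₁, ha₁, hr₁, rfl⟩ := (mem_marked he).1 hc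
    simp only [hpos] at hc1 hc2
    obtain ⟨rfl, hs⟩ := same_strip_of_close (ρ := ρ) he hκ hη ha ha₁ (by linarith) (by linarith)
    simp only [markedPos] at hc1 hc2
    rw [← hs] at hc1 hc2
    -- A string strictly in between would have row plus column strictly between two consecutive
    -- integers.
    have h1 : ((a₁.1 + a₁.2 : ℕ) : ℝ) < ((a.1 + a.2 : ℕ) : ℝ) := by
      push_cast
      exact lt_of_mul_lt_mul_right (by linarith) hη.1.le
    have h2 : ((a.1 + a.2 : ℕ) : ℝ) < ((a₁.1 + a₁.2 + 1 : ℕ) : ℝ) := by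
      push_cast
      exact lt_of_mul_lt_mul_right (by linarith) hη.1.le
    rw [Nat.cast_lt] at h1 h2
    omega

theorem IsMaximalCloseTuple.stripContent_nonneg_iff (he : 1 ≤ e)
    (hκ : IsAsymptotic (size lam) κ) (hη : IsSpacing (fun _ : ZMod (e + 1) => 1) lam η)
    (hδ : η < δ) (hδ' : δ ≤ 1 / 2) {l : List (ℝ × ZMod (e + 1))} {m : Fin ℓ} {a : ℕ × ℕ}
    (h : IsMaximalCloseTuple δ (partitionIdempotent (fun _ => 1) κ ρ η lam) l)
    (hb : l.getLast? = some (markedPos κ ρ η lam m a, boxRes (ρ m) a))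
    (ha : a ∈ (lam m).cells) (hr : boxRes (ρ m) a = 0 ∨ boxRes (ρ m) a = 1) :
    0 ≤ stripContent (ρ m) a ↔ boxRes (ρ m) a = 0 := by
  have h01 := zero_ne_one_zmod he
  obtain ⟨r, c⟩ := a
  constructor
  · intro hn
    by_contra h0
    have h1 := hr.resolve_left h0
    simp only [stripContent, h0, if_false, content] at hn
    obtain ⟨c, rfl⟩ : ∃ c', c = c' + 1 := ⟨c - 1, by omega⟩
    have hres' : boxRes (ρ m) (r, c) = 0 := by
      simp only [boxRes] at h1 ⊢
      push_cast at h1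
      linear_combination h1
    refine h.not_adjacent he hκ hη hδ hδ' hb ha (a' := (r, c)) ?_ hr (Or.inl hres')
      (Or.inl ⟨hres', rfl⟩)
    exact (lam m).isLowerSet (show (r, c) ≤ (r, c + 1) from ⟨le_rfl, Nat.le_succ _⟩) ha
  · intro h0
    by_contra hn
    simp only [stripContent, h0, if_true, content] at hn
    obtain ⟨r, rfl⟩ : ∃ r', r = r' + 1 := ⟨r - 1, by omega⟩
    have hres' : boxRes (ρ m) (r, c) = 1 := by
      simp only [boxRes] at h0 ⊢
      push_cast at h0
      linear_combination h0
    refine h.not_adjacent he hκ hη hδ hδ' hb ha (a' := (r, c)) ?_ hr (Or.inr hres')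
      (Or.inr ⟨hres', rfl⟩)
    exact (lam m).isLowerSet (show (r, c) ≤ (r + 1, c) from ⟨Nat.le_succ _, le_rfl⟩) ha

theorem IsMaximalCloseTuple.content_nonneg_iff (he : 1 ≤ e)
    (hκ : IsAsymptotic (size lam) κ) (hη : IsSpacing (fun _ : ZMod (e + 1) => 1) lam η)
    (hδ : η < δ) (hδ' : δ ≤ 1 / 2) {l : List (ℝ × ZMod (e + 1))} {m : Fin ℓ} {a : ℕ × ℕ}
    (h : IsMaximalCloseTuple δ (partitionIdempotent (fun _ => 1) κ ρ η lam) l)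
    (ha : a ∈ (lam m).cells) (h0 : boxRes (ρ m) a = 0)
    (hal : (markedPos κ ρ η lam m a, (0 : ZMod (e + 1))) ∈ l) {b : ℝ × ZMod (e + 1)}
    (hb : l.getLast? = some b) : (b.2 = 0 ∨ b.2 = 1) ∧ (0 ≤ content a ↔ b.2 = 0) := by
  -- Consecutive members are less than `1/2` apart, so the whole tuple stays in one component and on
  -- one pair of diagonals.
  have hQ := List.IsChain.forall_mem_of_iff
    (Q := fun p => ∃ a' ∈ (lam m).cells, (boxRes (ρ m) a' = 0 ∨ boxRes (ρ m) a' = 1) ∧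
      (markedPos κ ρ η lam m a', boxRes (ρ m) a') = p ∧
        stripContent (ρ m) a' = stripContent (ρ m) a) h.1.2.2 (by
      intro x hx y hy hxy
      obtain ⟨m₁, a₁, ha₁, hr₁, rfl⟩ := (mem_marked he).1 (h.1.2.1 x hx)
      obtain ⟨m₂, a₂, ha₂, hr₂, rfl⟩ := (mem_marked he).1 (h.1.2.1 y hy)
      obtain ⟨hxy1, hxy2, -⟩ := hxy
      simp only at hxy1 hxy2
      constructor
      · rintro ⟨a', ha', hr', heq, hs⟩
        rw [Prod.mk.injEq] at heq
        obtain ⟨rfl, hs'⟩ := same_strip_of_close (ρ := ρ) he hκ hη ha' ha₂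
          (by rw [heq.1]; linarith) (by rw [heq.1]; linarith)
        exact ⟨a₂, ha₂, hr₂, rfl, hs'.symm.trans hs⟩
      · rintro ⟨a', ha', hr', heq, hs⟩
        rw [Prod.mk.injEq] at heq
        obtain ⟨rfl, hs'⟩ := same_strip_of_close (ρ := ρ) he hκ hη ha' ha₁
          (by rw [heq.1]; linarith) (by rw [heq.1]; linarith)
        exact ⟨a₁, ha₁, hr₁, rfl, hs'.symm.trans hs⟩)
    hal ⟨a, ha, Or.inl h0, by rw [h0], rfl⟩ b (List.mem_of_getLast? hb)
  obtain ⟨a', ha', hr', rfl, hs⟩ := hQ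
  refine ⟨hr', ?_⟩
  have := h.stripContent_nonneg_iff he hκ hη hδ hδ' hb ha' hr'
  rw [hs, stripContent, if_pos h0] at this
  exact this

theorem inTuple_iff (he : 1 ≤ e) (hκ : IsAsymptotic (size lam) κ)
    (hη : IsSpacing (fun _ : ZMod (e + 1) => 1) lam η) (hδ : η < δ) (hδ' : δ ≤ 1 / 2)
    {m : Fin ℓ} {a : ℕ × ℕ} (ha : a ∈ (lam m).cells) (h0 : boxRes (ρ m) a = 0) :
    (InTuple δ (partitionIdempotent (fun _ => 1) κ ρ η lam) 0 (markedPos κ ρ η lam m a)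
      ↔ 0 ≤ content a) ∧
    (InTuple δ (partitionIdempotent (fun _ => 1) κ ρ η lam) 1 (markedPos κ ρ η lam m a)
      ↔ content a < 0) := by
  have h01 := zero_ne_one_zmod he
  obtain ⟨l, hl, hal⟩ := exists_maximalCloseTuple (δ := δ)
    ((mem_marked (p := (markedPos κ ρ η lam m a, (0 : ZMod (e + 1)))) he).2
      ⟨m, a, ha, Or.inl h0, by rw [h0]⟩)
  obtain ⟨b, hb⟩ : ∃ b, l.getLast? = some b :=
    ⟨l.getLast hl.1.1, List.getLast?_eq_some_getLast _⟩
  obtain ⟨hb01, hbc⟩ := hl.content_nonneg_iff he hκ hη hδ hδ' ha h0 hal hb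
  constructor
  · constructor
    · rintro ⟨l', hl', hal', b', hb', hb0'⟩
      exact (hl'.content_nonneg_iff he hκ hη hδ hδ' ha h0 hal' hb').2.2 hb0'
    · intro h
      exact ⟨l, hl, hal, b, hb, hbc.1 h⟩
  · constructor
    · rintro ⟨l', hl', hal', b', hb', hb0'⟩
      by_contra h
      have := (hl'.content_nonneg_iff he hκ hη hδ hδ' ha h0 hal' hb').2.1 (not_lt.1 h)
      exact h01 (this.symm.trans hb0')
    · intro h
      exact ⟨l, hl, hal, b, hb, hb01.resolve_left fun h' => not_le.2 h (hbc.2 h')⟩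

end Tuples

/-! ## Straight-line deformations -/

/-- Two non-zero reals of the same sign. -/
def SameSide (u v : ℝ) : Prop := (0 < u ∧ 0 < v) ∨ (u < 0 ∧ v < 0)

theorem SameSide.segment_ne_zero {u v s : ℝ} (h : SameSide u v) (hs : s ∈ Set.Icc (0 : ℝ) 1) :
    (1 - s) * u + s * v ≠ 0 := by
  obtain ⟨h0, h1⟩ := hs
  rcases h with ⟨hu, hv⟩ | ⟨hu, hv⟩
  · rcases h0.eq_or_lt with rfl | h0
    · simpa using hu.ne'
    · have := mul_pos h0 hv
      have := mul_nonneg (sub_nonneg.2 h1) hu.le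
      exact ne_of_gt (by linarith)
  · rcases h0.eq_or_lt with rfl | h0
    · simpa using hu.ne
    · have := mul_neg_of_pos_of_neg h0 hv
      have := mul_nonpos_of_nonneg_of_nonpos (sub_nonneg.2 h1) hu.le
      exact ne_of_lt (by linarith)

/-- A non-zero multiple of `η` dominates `τ`; only for `k = 0` does the sign of `τ` decide. -/
theorem sameSide_of_int {k j : ℤ} {τ η η' : ℝ} (hη' : 0 < η') (hτ : |τ| < η)
    (h : ((1 ≤ k ∨ (k = 0 ∧ 0 < τ)) ∧ 1 ≤ j) ∨ ((k ≤ -1 ∨ (k = 0 ∧ τ < 0)) ∧ j ≤ -1)) :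
    SameSide (k * η + τ) (j * η') := by
  obtain ⟨h1, h2⟩ := abs_lt.1 hτ
  rcases h with ⟨hk, hj⟩ | ⟨hk, hj⟩
  · have hj' : (0 : ℝ) < j := by exact_mod_cast hj
    refine Or.inl ⟨?_, mul_pos hj' hη'⟩
    rcases hk with hk | ⟨rfl, hk⟩
    · have hk' : (1 : ℝ) ≤ k := by exact_mod_cast hk
      have := mul_le_mul_of_nonneg_right hk' (show 0 ≤ η by linarith)
      linarith
    · simpa using hk
  · have hj' : (j : ℝ) < 0 := by exact_mod_cast (show j < 0 by omega)
    refine Or.inr ⟨?_, mul_neg_of_neg_of_pos hj' hη'⟩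
    rcases hk with hk | ⟨rfl, hk⟩
    · have hk' : (k : ℝ) ≤ -1 := by exact_mod_cast hk
      have := mul_le_mul_of_nonneg_right hk' (show 0 ≤ η by linarith)
      linarith
    · simpa using hk

/-- Strings move along segments, so each exceptional difference is a convex combination of two
numbers of the same sign. -/
theorem IdempotentDiagram.equivalent_of_sameSide {N ℓ : ℕ} {ι : Type*}
    {Y Z : IdempotentDiagram N ℓ}
    (hs : Z.shift = Y.shift) (hp : Z.redPos = Y.redPos) (hr : Z.redRes = Y.redRes)
    (T : Finset ι) (x y : ι → ℝ) (res : ι → ZMod N)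
    (hY : Y.solid = T.val.map fun p => (x p, res p))
    (hZ : Z.solid = T.val.map fun p => (y p, res p))
    (h1 : ∀ p ∈ T, ∀ q ∈ T, p ≠ q → res p = res q → SameSide (x p - x q) (y p - y q))
    (h2 : ∀ p ∈ T, ∀ q ∈ T, res q = res p + 1 →
      SameSide (x p + Y.shift (res p) - x q) (y p + Y.shift (res p) - y q))
    (h3 : ∀ p ∈ T, ∀ m, res p = Y.redRes m →
      SameSide (x p - Y.redPos m) (y p - Y.redPos m)) :
    Y.Equivalent Z := by
  set f : Fin T.card → ι := fun j => (T.equivFin.symm j : ι) with hf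
  have hfT : ∀ j, f j ∈ T := fun j => (T.equivFin.symm j).2
  have hfi : Function.Injective f := fun i j h => T.equivFin.symm.injective (Subtype.ext h)
  have hmap : T.val = (Finset.univ : Finset (Fin T.card)).val.map f := by
    classical
    have : T = (Finset.univ : Finset (Fin T.card)).map ⟨f, hfi⟩ := by
      ext p
      simp only [Finset.mem_map, Finset.mem_univ, true_and, Function.Embedding.coeFn_mk]
      constructor
      · intro hp
        exact ⟨T.equivFin ⟨p, hp⟩, by simp [hf]⟩
      · rintro ⟨j, rfl⟩
        exact hfT j
    conv_lhs => rw [this]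
    rfl
  refine ⟨hs, hp, hr, T.card, fun j => res (f j),
    fun j s => (1 - s) * x (f j) + s * y (f j), ?_, ?_, ?_, ?_⟩
  · intro j
    fun_prop
  · rw [hY, hmap, Multiset.map_map]
    simp
  · rw [hZ, hmap, Multiset.map_map]
    simp
  · intro s hs
    refine ⟨fun j j' hj hres h => ?_, fun j j' hres h => ?_, fun j m hres h => ?_⟩
    · refine (h1 _ (hfT j) _ (hfT j') (hfi.ne hj) hres).segment_ne_zero hs ?_
      linear_combination h
    · refine (h2 _ (hfT j) _ (hfT j') hres).segment_ne_zero hs ?_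
      linear_combination h
    · refine (h3 _ (hfT j) m hres).segment_ne_zero hs ?_
      linear_combination h

/-! ## The strings of the two diagrams -/

section Strings

variable {e ℓ : ℕ} {lam : Fin ℓ → YoungDiagram} {ρ : Fin ℓ → ZMod (e + 1)} {κ : Fin ℓ → ℤ}
  {η η' δ t ε : ℝ}

/-- The indices of the solid strings of the subdivided diagram. -/
def strings (ρ : Fin ℓ → ZMod (e + 1)) (lam : Fin ℓ → YoungDiagram) :
    Finset ((_ : Fin ℓ) × (_ : ℕ × ℕ) × Bool) :=
  Finset.univ.sigma fun m => copies (ρ m) (lam m)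

/-- The content of the diagonal, measured with unit ghost shifts, at which a string starts. -/
def diagonal (p : (_ : ℕ × ℕ) × Bool) : ℤ := content p.1 + if p.2 then 1 else 0

/-- The distance of an added string from the ghost string that it belongs to. -/
def offset (t : ℝ) (p : (_ : ℕ × ℕ) × Bool) : ℝ :=
  if p.2 then (if 0 ≤ content p.1 then -t else t) else 0

/-- The small part of the position of a string of the subdivided diagram. -/
def startShift (η t : ℝ) (p : (_ : ℕ × ℕ) × Bool) : ℝ :=
  offset t p - ((p.1.1 : ℝ) + p.1.2 + 2) * η

/-- The small part of the position of a string of the diagram of `lam⁺`. -/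
def endShift (ρ : ZMod (e + 1)) (η' ε : ℝ) (p : (_ : ℕ × ℕ) × Bool) : ℝ :=
  ε * crossings ρ (content p.1) - (((newBox ρ p).1 : ℝ) + (newBox ρ p).2 + 2) * η'

theorem mem_strings {m : Fin ℓ} {p : (_ : ℕ × ℕ) × Bool} :
    ⟨m, p⟩ ∈ strings ρ lam ↔ p ∈ copies (ρ m) (lam m) := by simp [strings]

theorem partitionIdempotent_plus_solid (he : 1 ≤ e) :
    (partitionIdempotent (subdivideShift ε (fun _ : ZMod (e + 1) => 1)) κ
      (fun m => relabel (ρ m)) η' fun m => plusDiagram (ρ m) (lam m)).solid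
    = (strings ρ lam).val.map fun p =>
      (base κ (affineLevel (e + 2) fun m => plusDiagram (ρ m) (lam m)) p.1 (diagonal p.2)
        + endShift (ρ p.1) η' ε p.2, newRes (ρ p.1) p.2) := by
  have hval : (strings ρ lam).val = (Finset.univ : Finset (Fin ℓ)).val.bind fun m =>
      (copies (ρ m) (lam m)).val.map (Sigma.mk m) := rfl
  rw [hval, Multiset.map_bind]
  change ((Finset.univ : Finset (Fin ℓ)).val.bind _) = _
  refine Multiset.bind_congr fun m _ => ?_
  rw [plusDiagram_cells_val, Multiset.map_map, Multiset.map_map]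
  refine Multiset.map_congr rfl fun p hp => ?_
  have hc : ((newBox (ρ m) p).2 : ℤ) - ((newBox (ρ m) p).1 : ℤ) = _ := content_newBox (ρ := ρ m) p
  have hw : weightedContent (subdivideShift ε (fun _ : ZMod (e + 1) => 1)) (relabel (ρ m))
      (((newBox (ρ m) p).2 : ℤ) - ((newBox (ρ m) p).1 : ℤ))
      = diagonal p + ε * crossings (ρ m) (content p.1) := by
    rw [hc, diagonal]
    split_ifs
    · rw [add_assoc, weightedContent_subdivideShift_extra he]
      push_cast
      ring
    · rw [add_zero, weightedContent_subdivideShift he]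
      push_cast
      ring
  simp only [Function.comp, boxRes_newBox he hp, coord, hw, base, endShift]
  refine Prod.ext ?_ rfl
  simp only
  ring

theorem subdivide_solid (he : 1 ≤ e) (hκ : IsAsymptotic (size lam) κ)
    (hη : IsSpacing (fun _ : ZMod (e + 1) => 1) lam η) (hδ : η < δ) (hδ' : δ ≤ 1 / 2) :
    (subdivide t ε δ (partitionIdempotent (fun _ : ZMod (e + 1) => 1) κ ρ η lam)).solid
    = (strings ρ lam).val.map fun p =>
      (base κ (affineLevel (e + 1) lam) p.1 (diagonal p.2) + startShift η t p.2,
        newRes (ρ p.1) p.2) := by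
  classical
  have hval : (strings ρ lam).val = (Finset.univ : Finset (Fin ℓ)).val.bind fun m =>
      (lam m).cells.val.bind fun a => (if boxRes (ρ m) a = 0 then Finset.univ else {false}).val.map
        fun b => ⟨m, a, b⟩ := by
    have h1 : (strings ρ lam).val = (Finset.univ : Finset (Fin ℓ)).val.bind fun m =>
      ((lam m).cells.val.bind fun a => (if boxRes (ρ m) a = 0 then Finset.univ
        else {false}).val.map (Sigma.mk a)).map (Sigma.mk m) := rfl
    rw [h1]
    refine Multiset.bind_congr fun m _ => ?_
    rw [Multiset.map_bind]
    refine Multiset.bind_congr fun a _ => ?_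
    rw [Multiset.map_map]
    rfl
  have hsol : (partitionIdempotent (fun _ : ZMod (e + 1) => 1) κ ρ η lam).solid
      = (Finset.univ : Finset (Fin ℓ)).val.bind fun m => (lam m).cells.val.bind fun a =>
        {(coord (fun _ => 1) κ ρ η lam m a, boxRes (ρ m) a)} := by
    change ((Finset.univ : Finset (Fin ℓ)).val.bind _) = _
    refine Multiset.bind_congr fun m _ => ?_
    rw [Multiset.bind_singleton]
  have hfil : ((partitionIdempotent (fun _ : ZMod (e + 1) => 1) κ ρ η lam).solid.filter
        fun p => p.2 = 0)
      = (Finset.univ : Finset (Fin ℓ)).val.bind fun m => (lam m).cells.val.bind fun a =>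
        if boxRes (ρ m) a = 0 then {(coord (fun _ => 1) κ ρ η lam m a, boxRes (ρ m) a)} else 0 := by
    rw [hsol, Multiset.filter_bind]
    refine Multiset.bind_congr fun m _ => ?_
    rw [Multiset.filter_bind]
    refine Multiset.bind_congr fun a _ => ?_
    rw [Multiset.filter_singleton]
    rfl
  rw [subdivide]
  simp only
  rw [hfil, hsol, hval]
  simp only [Multiset.map_bind, Multiset.bind_assoc]
  rw [← Multiset.bind_add]
  refine Multiset.bind_congr fun m _ => ?_
  rw [← Multiset.bind_add]
  refine Multiset.bind_congr fun a ha => ?_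
  have e1 : (coord (fun _ => 1) κ ρ η lam m a, relabel (boxRes (ρ m) a))
      = (base κ (affineLevel (e + 1) lam) m (diagonal ⟨a, false⟩) + startShift η t ⟨a, false⟩,
        newRes (ρ m) ⟨a, false⟩) := by
    rw [coord_one]
    simp [diagonal, startShift, offset, newRes, sub_eq_add_neg]
  by_cases h0 : boxRes (ρ m) a = 0
  · have huniv : (Finset.univ : Finset Bool).val = {true, false} := rfl
    have hg : coord (fun _ => 1) κ ρ η lam m a + 1 = markedPos κ ρ η lam m a :=
      (markedPos_of_zero h0).symm
    have hin := inTuple_iff he hκ hη hδ hδ' ha h0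
    have hsh : (partitionIdempotent (fun _ : ZMod (e + 1) => 1) κ ρ η lam).shift 0 = 1 := rfl
    simp only [h0, if_true, Multiset.map_singleton, Multiset.singleton_bind, hsh, hg, hin.1,
      hin.2, huniv]
    rw [h0] at e1
    rw [e1]
    simp only [Multiset.insert_eq_cons, Multiset.map_cons, Multiset.map_singleton]
    -- The ghost of a `0`-node of content `d` sits on the diagonal `d + 1`, which is the `diagonal`
    -- of the added index.
    have e2 : (if 0 ≤ content a then {(markedPos κ ρ η lam m a - t, (1 : ZMod (e + 2)))}
        else if content a < 0 then {(markedPos κ ρ η lam m a + t, 1)} else 0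
          : Multiset (ℝ × ZMod (e + 2)))
        = {(base κ (affineLevel (e + 1) lam) m (diagonal ⟨a, true⟩) + startShift η t ⟨a, true⟩,
          newRes (ρ m) ⟨a, true⟩)} := by
      simp only [markedPos, stripContent, h0, if_true, diagonal, startShift, offset, newRes]
      split_ifs with h1 h2
      · congr 2
        ring
      · congr 2
        ring
      · omega
    rw [e2, ← Multiset.singleton_add]
    exact add_comm _ _
  · simp only [h0, if_false]
    simp [e1]

end Strings

section Comparison

variable {e ℓ : ℕ} {lam : Fin ℓ → YoungDiagram} {ρ : Fin ℓ → ZMod (e + 1)} {κ : Fin ℓ → ℤ}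
  {η η' δ t ε : ℝ}

/-! ## Comparing positions -/

theorem card_cells_le_plus (ρ : ZMod (e + 1)) (lam : YoungDiagram) :
    lam.cells.card ≤ (plusDiagram ρ lam).cells.card := by
  have h1 : (plusDiagram ρ lam).cells.card = (copies ρ lam).card := by
    rw [Finset.card_def, plusDiagram_cells_val, Multiset.card_map]
    rfl
  rw [h1]
  refine Finset.card_le_card_of_injOn (fun a => ⟨a, false⟩) ?_ ?_
  · intro a ha
    exact mem_copies.2 ⟨ha, by simp⟩
  · intro a _ a' _ h
    exact congrArg Sigma.fst h

theorem affineLevel_le_plus (ρ : Fin ℓ → ZMod (e + 1)) (lam : Fin ℓ → YoungDiagram) :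
    affineLevel (e + 1) lam ≤ affineLevel (e + 2) fun m => plusDiagram (ρ m) (lam m) := by
  have h : size lam ≤ size fun m => plusDiagram (ρ m) (lam m) :=
    Finset.sum_le_sum fun m _ => card_cells_le_plus (ρ m) (lam m)
  rw [affineLevel, affineLevel]
  exact Nat.add_le_add_left (Nat.mul_le_mul h (by omega)) _

theorem abs_offset_lt (h : IsHomogeneous η t ε) (p : (_ : ℕ × ℕ) × Bool) :
    -η < offset t p ∧ offset t p + ε < η := by
  obtain ⟨ht, hε, hs⟩ := h
  rw [offset]
  split_ifs <;> constructor <;> linarith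

theorem startShift_bounds (he : 1 ≤ e) (hη : IsSpacing (fun _ : ZMod (e + 1) => 1) lam η)
    (h : IsHomogeneous η t ε) {m : Fin ℓ} {p : (_ : ℕ × ℕ) × Bool}
    (hp : p ∈ copies (ρ m) (lam m)) :
    -(1 / 2) < startShift η t p ∧ startShift η t p + ε < 0 ∧
      (p.2 = false → -(1 / (affineLevel (e + 1) lam : ℝ)) < startShift η t p) := by
  have ha := (mem_copies.1 hp).1
  obtain ⟨hL, hn, -⟩ := affineLevel_ge he ha
  have h1 := size_mul_lt_div hη (by omega) 0
  have hL' : (3 : ℝ) ≤ affineLevel (e + 1) lam := by exact_mod_cast hL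
  set M : ℝ := ((affineLevel (e + 1) lam : ℕ) : ℝ)
  have h2 : 1 / (2 * M) = 1 / M / 2 := by ring
  have h3 : 1 / M ≤ 1 / 3 := one_div_le_one_div_of_le (by norm_num) hL'
  have h4 := (lam m).add_lt_card ha
  have h5 := card_le_size lam m
  have h6 : ((p.1.1 : ℝ) + p.1.2 + 2) * η ≤ 2 * (size lam * η) := by
    rw [← mul_assoc]
    refine mul_le_mul_of_nonneg_right ?_ hη.1.le
    exact_mod_cast (by omega : p.1.1 + p.1.2 + 2 ≤ 2 * size lam)
  have h7 : 2 * η ≤ ((p.1.1 : ℝ) + p.1.2 + 2) * η := by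
    refine mul_le_mul_of_nonneg_right ?_ hη.1.le
    have : (0 : ℝ) ≤ (p.1.1 : ℝ) + p.1.2 := by positivity
    linarith
  have h8 : 1 * η ≤ size lam * η :=
    mul_le_mul_of_nonneg_right (by exact_mod_cast hn) hη.1.le
  have h9 := abs_offset_lt h p
  have h10 := hη.1
  rw [startShift]
  refine ⟨by linarith, by linarith, fun hb => ?_⟩
  rw [offset, hb]
  simp only [Bool.false_eq_true, if_false]
  linarith

/-- The smallest ghost shift is that of the new edge, so admissibility of `η'` keeps these terms
below `ε`. -/
theorem newBox_spacing (hη' : IsSpacing (subdivideShift ε (fun _ : ZMod (e + 1) => 1))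
      (fun m => plusDiagram (ρ m) (lam m)) η') (hε : 0 < ε) (he : 1 ≤ e)
    {m : Fin ℓ} {p : (_ : ℕ × ℕ) × Bool} (hp : p ∈ copies (ρ m) (lam m)) :
    0 < (((newBox (ρ m) p).1 : ℝ) + (newBox (ρ m) p).2 + 2) * η' ∧
    (((newBox (ρ m) p).1 : ℝ) + (newBox (ρ m) p).2 + 2) * η' < ε := by
  set mu : Fin ℓ → YoungDiagram := fun m => plusDiagram (ρ m) (lam m) with hmu
  have hmem : newBox (ρ m) p ∈ (mu m).cells := Finset.mem_image_of_mem _ hp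
  have hL := affineLevel_ge (e := e + 1) (by omega) hmem
  have h1 := size_mul_lt_div hη' (by rw [show e + 2 = e + 1 + 1 from rfl]; omega) 1
  rw [subdivideShift_one] at h1
  have hL' : (1 : ℝ) ≤ affineLevel (e + 2) mu := by
    exact_mod_cast (show 1 ≤ affineLevel (e + 1 + 1) mu by omega)
  have h2 : ε / (2 * (affineLevel (e + 2) mu : ℝ)) ≤ ε / 2 :=
    div_le_div_of_nonneg_left hε.le (by norm_num) (by linarith)
  have h4 := (mu m).add_lt_card hmem
  have h5 := card_le_size mu m
  have h6 : (((newBox (ρ m) p).1 : ℝ) + (newBox (ρ m) p).2 + 2) * η' ≤ 2 * (size mu * η') := by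
    rw [← mul_assoc]
    refine mul_le_mul_of_nonneg_right ?_ hη'.1.le
    exact_mod_cast (by omega : (newBox (ρ m) p).1 + (newBox (ρ m) p).2 + 2 ≤ 2 * size mu)
  exact ⟨mul_pos (by positivity) hη'.1, by linarith⟩

/-- At most `size lam - 1` passages contribute `ε` each and the `η'`-term less than one more, so the
total is controlled by `size lam * η < 1 / (2 M)`, with `M` the old level. -/
theorem endShift_bounds (he : 1 ≤ e) (hη : IsSpacing (fun _ : ZMod (e + 1) => 1) lam η)
    (h : IsHomogeneous η t ε)
    (hη' : IsSpacing (subdivideShift ε (fun _ : ZMod (e + 1) => 1))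
      (fun m => plusDiagram (ρ m) (lam m)) η')
    {m : Fin ℓ} {p : (_ : ℕ × ℕ) × Bool} (hp : p ∈ copies (ρ m) (lam m)) :
    -(1 / (affineLevel (e + 1) lam : ℝ)) < endShift (ρ m) η' ε p ∧
      endShift (ρ m) η' ε p + ε < 1 / 6 := by
  have ha := (mem_copies.1 hp).1
  obtain ⟨hL, hn, -⟩ := affineLevel_ge he ha
  have h1 := size_mul_lt_div hη (by omega) 0
  have hL' : (3 : ℝ) ≤ affineLevel (e + 1) lam := by exact_mod_cast hL
  set M : ℝ := ((affineLevel (e + 1) lam : ℕ) : ℝ)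
  have h2 : 1 / (2 * M) = 1 / M / 2 := by ring
  have h3 : 1 / M ≤ 1 / 3 := one_div_le_one_div_of_le (by norm_num) hL'
  have h3' : 0 < 1 / M := by positivity
  obtain ⟨ht, hε, hs⟩ := h
  have hsp := newBox_spacing hη' hε he hp
  have h4 := abs_content_lt ha
  have h5 := card_le_size lam m
  have h6 := abs_crossings_le (ρ m) (content p.1)
  have h7 := abs_le.1 h6
  have h8 : -((size lam : ℝ) - 1) ≤ crossings (ρ m) (content p.1) := by
    have : -((size lam : ℤ) - 1) ≤ crossings (ρ m) (content p.1) := by omega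
    exact_mod_cast this
  have h9 : (crossings (ρ m) (content p.1) : ℝ) ≤ (size lam : ℝ) - 1 := by
    have : crossings (ρ m) (content p.1) ≤ (size lam : ℤ) - 1 := by omega
    exact_mod_cast this
  have h10 := mul_le_mul_of_nonneg_left h8 hε.le
  have h11 := mul_le_mul_of_nonneg_left h9 hε.le
  have h12 : size lam * ε ≤ size lam * η :=
    mul_le_mul_of_nonneg_left (by linarith) (Nat.cast_nonneg _)
  rw [endShift]
  constructor <;> linarith

/-- The gap of at least `2/3` exceeds the spread of the shifts, less than `1/2` at either end. The
slack of one in `hDD` is affordable because contents in two different components differ by at most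
`size lam - 2`. -/
theorem sameSide_of_base (he : 1 ≤ e) (hκ : IsAsymptotic (size lam) κ)
    {m m' : Fin ℓ} {p q : (_ : ℕ × ℕ) × Bool} (hp : p ∈ copies (ρ m) (lam m))
    (hq : q ∈ copies (ρ m') (lam m')) {D D' : ℤ}
    (hDD : |(D - content p.1) - (D' - content q.1)| ≤ 1)
    (hne : ¬ (m = m' ∧ D = D')) {M' u u' v v' : ℝ} (hM' : (affineLevel (e + 1) lam : ℝ) ≤ M')
    (hu : -(1 / 2) < u ∧ u < 0) (hu' : -(1 / 2) < u' ∧ u' < 0)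
    (hv : -(1 / (affineLevel (e + 1) lam : ℝ)) < v ∧ v < 1 / 6)
    (hv' : -(1 / (affineLevel (e + 1) lam : ℝ)) < v' ∧ v' < 1 / 6) :
    SameSide (base κ (affineLevel (e + 1) lam) m D + u
        - (base κ (affineLevel (e + 1) lam) m' D' + u'))
      (base κ M' m D + v - (base κ M' m' D' + v')) := by
  have ha := (mem_copies.1 hp).1
  have ha' := (mem_copies.1 hq).1
  obtain ⟨hL, hn, -⟩ := affineLevel_ge he ha
  have hL' : (3 : ℝ) ≤ affineLevel (e + 1) lam := by exact_mod_cast hL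
  set M : ℝ := ((affineLevel (e + 1) lam : ℕ) : ℝ)
  have h3 : 1 / M ≤ 1 / 3 := one_div_le_one_div_of_le (by norm_num) hL'
  have h4 : 1 / M' ≤ 1 / 3 := one_div_le_one_div_of_le (by norm_num) (hL'.trans hM')
  have hdich := base_dichotomy hκ hn hne (fun hm => by
    have h1 := abs_lt.1 (abs_content_lt ha)
    have h2 := abs_lt.1 (abs_content_lt ha')
    have h3 := card_add_card_le_size lam hm
    have h4 := abs_le.1 hDD
    rw [abs_le]
    constructor <;> omega)
  rcases hdich with hd | hd
  · have h1 := hd M (by linarith)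
    have h2 := hd M' (by linarith)
    exact Or.inr ⟨by linarith, by linarith⟩
  · have h1 := hd M (by linarith)
    have h2 := hd M' (by linarith)
    exact Or.inl ⟨by linarith, by linarith⟩

theorem sameSide_red (he : 1 ≤ e) (hκ : IsAsymptotic (size lam) κ)
    (hη : IsSpacing (fun _ : ZMod (e + 1) => 1) lam η) (h : IsHomogeneous η t ε)
    (hη' : IsSpacing (subdivideShift ε (fun _ : ZMod (e + 1) => 1))
      (fun m => plusDiagram (ρ m) (lam m)) η')
    {m : Fin ℓ} (m' : Fin ℓ) {p : (_ : ℕ × ℕ) × Bool} (hp : p ∈ copies (ρ m) (lam m))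
    (hb : p.2 = false) {M' : ℝ} (hM' : (affineLevel (e + 1) lam : ℝ) ≤ M') :
    SameSide (base κ (affineLevel (e + 1) lam) m (diagonal p) + startShift η t p - κ m')
      (base κ M' m (diagonal p) + endShift (ρ m) η' ε p - κ m') := by
  have ha := (mem_copies.1 hp).1
  obtain ⟨hL, hn, hℓ⟩ := affineLevel_ge he ha
  have hd : diagonal p = content p.1 := by simp [diagonal, hb]
  rw [hd]
  obtain ⟨hu1, hu2, hu3⟩ := startShift_bounds (ρ := ρ) he hη h hp
  obtain ⟨hv1, hv2⟩ := endShift_bounds he hη h hη' hp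
  have hu3 := hu3 hb
  have hsp := newBox_spacing hη' h.2.1 he hp
  have hε := h.2.1
  have hL' : (3 : ℝ) ≤ affineLevel (e + 1) lam := by exact_mod_cast hL
  have hℓ' : ((m : ℕ) : ℝ) + 1 + 2 ≤ affineLevel (e + 1) lam := by
    have := m.isLt
    exact_mod_cast (show (m : ℕ) + 1 + 2 ≤ affineLevel (e + 1) lam by omega)
  set M : ℝ := ((affineLevel (e + 1) lam : ℕ) : ℝ)
  have hm0 : (0 : ℝ) < ((m : ℕ) : ℝ) + 1 := by positivity
  have h1 : (((m : ℕ) : ℝ) + 1) / M + 1 / M ≤ 1 := by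
    rw [← add_div, div_le_one (by linarith)]
    linarith
  have h2 : (((m : ℕ) : ℝ) + 1) / M' ≤ (((m : ℕ) : ℝ) + 1) / M :=
    div_le_div_of_nonneg_left hm0.le (by linarith) hM'
  have h3 : 0 < (((m : ℕ) : ℝ) + 1) / M' := div_pos hm0 (by linarith)
  have hcb := abs_lt.1 (abs_content_lt ha)
  have hcs := card_le_size lam m
  -- The string stays to the left exactly in this case. For `m = m'` and non-positive content the
  -- `ε`-term is non-positive; in all other cases an integral gap of at least one absorbs the small
  -- terms.
  by_cases hc : (m ≤ m' ∧ content p.1 ≤ 0) ∨ m < m'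
  · right
    have key : (κ m : ℝ) + content p.1 ≤ κ m' := by
      rcases hc with ⟨hmm, hc⟩ | hmm
      · have := hκ.1.monotone hmm
        exact_mod_cast (by omega : κ m + content p.1 ≤ κ m')
      · have := hκ.2 m m' hmm
        exact_mod_cast (by omega : κ m + content p.1 ≤ κ m')
    refine ⟨by rw [base]; linarith, ?_⟩
    rcases hc with ⟨hmm, hc⟩ | hmm
    · have hz : (crossings (ρ m) (content p.1) : ℝ) ≤ 0 := by
        exact_mod_cast crossings_nonpos (ρ m) hc
      have hz' := mul_nonpos_of_nonneg_of_nonpos hε.le hz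
      rw [base, endShift]
      linarith
    · have key' : (κ m : ℝ) + content p.1 + 1 ≤ κ m' := by
        have := hκ.2 m m' hmm
        exact_mod_cast (by omega : κ m + content p.1 + 1 ≤ κ m')
      rw [base]
      linarith
  · left
    have key : (κ m' : ℝ) + 1 ≤ κ m + content p.1 := by
      rcases lt_trichotomy m m' with hmm | rfl | hmm
      · exact absurd (Or.inr hmm) hc
      · have : 0 < content p.1 := by
          by_contra h0
          exact hc (Or.inl ⟨le_rfl, by omega⟩)
        exact_mod_cast (by omega : κ m + 1 ≤ κ m + content p.1)
      · have := hκ.2 m' m hmm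
        exact_mod_cast (by omega : κ m' + 1 ≤ κ m + content p.1)
    rw [base, base]
    constructor <;> linarith

/-! ### Strings on a common diagonal of one component. -/

theorem boxSum_ne_of_ne {a b : ℕ × ℕ} (hab : a ≠ b) (h : content a = content b) :
    (a.1 : ℤ) + a.2 ≠ b.1 + b.2 := by
  intro hs
  simp only [content] at h
  exact hab (Prod.ext (by omega) (by omega))

/-- For negative content the `0`-node itself is counted, so `crossings` is at most `-1` and adding
one decreases the absolute value. -/
theorem abs_crossings_extra {N : ℕ} {ρ : ZMod N} {a : ℕ × ℕ} (h : boxRes ρ a = 0) :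
    |crossings ρ (content a) + 1|
      = |crossings ρ (content a)| + if 0 ≤ content a then 1 else -1 := by
  rw [boxRes_eq] at h
  split_ifs with hc
  · have := crossings_nonneg ρ hc
    rw [abs_of_nonneg this, abs_of_nonneg (by omega)]
  · have := crossings_neg_of_res (not_le.1 hc) h
    rw [abs_of_nonpos (by omega), abs_of_nonpos (by omega)]
    ring

theorem crossings_of_content_eq {N : ℕ} {ρ : ZMod N} {a b : ℕ × ℕ}
    (h : content b = content a + 1) :
    crossings ρ (content b) = crossings ρ (content a) + if boxRes ρ a = 0 then 1 else 0 := by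
  rw [h, crossings_add_one, boxRes_eq]

theorem startShift_sub (η t : ℝ) (p q : (_ : ℕ × ℕ) × Bool) :
    startShift η t p - startShift η t q
      = (((q.1.1 : ℤ) + q.1.2 - (p.1.1 + p.1.2) : ℤ) : ℝ) * η + (offset t p - offset t q) := by
  rw [startShift, startShift]
  push_cast
  ring

theorem endShift_sub (ρ : ZMod (e + 1)) (η' ε : ℝ) (p q : (_ : ℕ × ℕ) × Bool) :
    endShift ρ η' ε p - endShift ρ η' ε q
      = ε * ((crossings ρ (content p.1) - crossings ρ (content q.1) : ℤ) : ℝ)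
        + (((q.1.1 : ℤ) + q.1.2 - (p.1.1 + p.1.2)
          + (|crossings ρ (content q.1) + if q.2 then 1 else 0|
            - |crossings ρ (content p.1) + if p.2 then 1 else 0|) : ℤ) : ℝ) * η' := by
  have h1 := newBox_sum (ρ := ρ) p
  have h2 := newBox_sum (ρ := ρ) q
  have h3 : (((q.1.1 : ℤ) + q.1.2 - (p.1.1 + p.1.2)
          + (|crossings ρ (content q.1) + if q.2 then 1 else 0|
            - |crossings ρ (content p.1) + if p.2 then 1 else 0|) : ℤ) : ℝ)
      = (((newBox ρ q).1 : ℤ) + (newBox ρ q).2 - ((newBox ρ p).1 + (newBox ρ p).2) : ℤ) := by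
    congr 1
    linarith
  rw [h3, endShift, endShift]
  push_cast
  ring

theorem sameSide_of_newRes_eq (hη : 0 < η) (hη' : 0 < η') {ρ : ZMod (e + 1)}
    {p q : (_ : ℕ × ℕ) × Bool} (hpq : p ≠ q)
    (hr : newRes ρ p = newRes ρ q) (hd : diagonal p = diagonal q) :
    SameSide (startShift η t p - startShift η t q)
      (endShift ρ η' ε p - endShift ρ η' ε q) := by
  obtain ⟨a, b⟩ := p
  obtain ⟨a', b'⟩ := q
  have hb : b = b' := by
    cases b <;> cases b'
    · rfl
    · exact absurd (by simpa [newRes] using hr) (relabel_ne_one _)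
    · exact absurd (by simpa [newRes] using hr.symm) (relabel_ne_one _)
    · rfl
  subst hb
  have hc : content a = content a' := by simpa [diagonal] using hd
  have hab : a ≠ a' := fun h => hpq (by rw [h])
  have hs := boxSum_ne_of_ne hab hc
  rw [startShift_sub, endShift_sub]
  simp only [offset, hc, sub_self, add_zero, Int.cast_zero, mul_zero, zero_add]
  have := sameSide_of_int (k := (a'.1 : ℤ) + a'.2 - (a.1 + a.2))
    (j := (a'.1 : ℤ) + a'.2 - (a.1 + a.2)) (τ := 0) hη' (by simpa using hη) (by omega)
  rwa [add_zero] at this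

theorem sameSide_of_newRes_add_one (h : IsHomogeneous η t ε) (hη' : 0 < η')
    {ρ : ZMod (e + 1)} {lam : YoungDiagram} {p q : (_ : ℕ × ℕ) × Bool}
    (hp : p ∈ copies ρ lam) (hq : q ∈ copies ρ lam) (hr : newRes ρ q = newRes ρ p + 1)
    (hd : (diagonal p + if p.2 then 0 else 1) = diagonal q) :
    SameSide (startShift η t p + (if p.2 then ε else 0) - startShift η t q)
      (endShift ρ η' ε p + (if p.2 then ε else 0) - endShift ρ η' ε q) := by
  have hη : 0 < η := by linarith [h.1, h.2.1, h.2.2]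
  have hx := startShift_sub η t p q
  have hy := endShift_sub ρ η' ε p q
  have hbp := abs_offset_lt h p
  have hbq := abs_offset_lt h q
  rw [mem_copies] at hp hq
  obtain ⟨a, b⟩ := p
  obtain ⟨a', b'⟩ := q
  rw [add_sub_right_comm, add_sub_right_comm, hx, hy]
  obtain ⟨ht, hε, hs⟩ := h
  cases b <;> cases b'
  · simp only [newRes, Bool.false_eq_true, if_false] at hr
    have hc : content a' = content a + 1 := by simpa [diagonal] using hd.symm
    have h0 : boxRes ρ a ≠ 0 := by
      intro h0
      rw [h0, relabel_zero, zero_add] at hr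
      exact relabel_ne_one _ hr
    have hz := crossings_of_content_eq (ρ := ρ) hc
    rw [if_neg h0, add_zero] at hz
    simp only [offset, hz, Bool.false_eq_true, if_false, sub_self, add_zero, Int.cast_zero,
      mul_zero, zero_add]
    have := sameSide_of_int (k := (a'.1 : ℤ) + a'.2 - (a.1 + a.2))
      (j := (a'.1 : ℤ) + a'.2 - (a.1 + a.2)) (τ := 0) hη' (by simpa using hη) (by
        simp only [content] at hc
        omega)
    rwa [add_zero] at this
  · have h0 : boxRes ρ a' = 0 := hq.2 rfl
    have hc : content a = content a' := by simpa [diagonal] using hd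
    have habs := abs_crossings_extra h0
    have ho : offset t ⟨a, false⟩ - offset t ⟨a', true⟩ = if 0 ≤ content a' then t else -t := by
      simp only [offset, Bool.false_eq_true, if_false, if_true]
      split_ifs <;> ring
    -- Equal contents make the difference of the sums even, so the correction `±1` cannot bring it
    -- to zero; if it is zero, the displacement by `t` has the sign of that correction.
    have hpar : ∃ i : ℤ, (a'.1 : ℤ) + a'.2 - (a.1 + a.2) = 2 * i := by
      simp only [content] at hc
      exact ⟨(a'.1 : ℤ) - a.1, by omega⟩
    obtain ⟨i, hi⟩ := hpar
    simp only [Bool.false_eq_true, if_false, if_true, add_zero, hc, habs, ho, hi, sub_self,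
      Int.cast_zero, mul_zero, zero_add, add_sub_cancel_left]
    refine sameSide_of_int hη' ?_ ?_
    · rw [abs_lt]
      split_ifs <;> constructor <;> linarith
    · have hn : (-t < 0) := by linarith
      split_ifs
      · simp only [ht, and_true]
        omega
      · simp only [hn, and_true]
        omega
  -- The ghost shift `ε` cancels against the additional crossing of `a'`. Contents differing by one
  -- make the difference of the sums odd, hence non-zero.
  · have h0 : boxRes ρ a = 0 := hp.2 rfl
    have hc : content a' = content a + 1 := by simpa [diagonal] using hd.symm
    have hz := crossings_of_content_eq (ρ := ρ) hc
    rw [if_pos h0] at hz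
    have key := sameSide_of_int (k := (a'.1 : ℤ) + a'.2 - (a.1 + a.2))
      (j := (a'.1 : ℤ) + a'.2 - (a.1 + a.2)) (τ := offset t ⟨a, true⟩ + ε) (η := η) hη'
      (abs_lt.2 ⟨by linarith, by linarith⟩) (by
        simp only [content] at hc
        omega)
    have ho : offset t ⟨a', false⟩ = 0 := by simp [offset]
    simp only [Bool.false_eq_true, if_false, if_true, add_zero, hz, ho, sub_zero, sub_self]
    convert key using 1
    · ring
    · push_cast
      ring
  · simp only [newRes, if_true] at hr
    have : Fact (1 < e + 2) := ⟨by omega⟩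
    exact absurd hr.symm (by simp)

/-! ### All exceptional pairs of the two diagrams. -/

theorem subdivideShift_newRes (ε : ℝ) (ρ : ZMod (e + 1)) (p : (_ : ℕ × ℕ) × Bool) :
    subdivideShift ε (fun _ : ZMod (e + 1) => 1) (newRes ρ p) = if p.2 then ε else 1 := by
  rw [newRes]
  split_ifs
  · exact subdivideShift_one ε
  · exact subdivideShift_relabel ε _

theorem subdivide_equivalent (he : 1 ≤ e) (hκ : IsAsymptotic (size lam) κ)
    (hη : IsSpacing (fun _ : ZMod (e + 1) => 1) lam η) (hδ : η < δ) (hδ' : δ ≤ 1 / 2)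
    (h : IsHomogeneous η t ε)
    (hη' : IsSpacing (subdivideShift ε (fun _ : ZMod (e + 1) => 1))
      (fun m => plusDiagram (ρ m) (lam m)) η') :
    (subdivide t ε δ (partitionIdempotent (fun _ : ZMod (e + 1) => 1) κ ρ η lam)).Equivalent
      (partitionIdempotent (subdivideShift ε (fun _ : ZMod (e + 1) => 1)) κ
        (fun m => relabel (ρ m)) η' fun m => plusDiagram (ρ m) (lam m)) := by
  have hM : (affineLevel (e + 1) lam : ℝ)
      ≤ affineLevel (e + 2) fun m => plusDiagram (ρ m) (lam m) := by
    exact_mod_cast affineLevel_le_plus ρ lam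
  have hε := h.2.1
  refine IdempotentDiagram.equivalent_of_sameSide rfl rfl rfl (strings ρ lam) _ _ _
    (subdivide_solid he hκ hη hδ hδ') (partitionIdempotent_plus_solid he) ?_ ?_ ?_
  · rintro ⟨m, p⟩ hp ⟨m', q⟩ hq hpq hr
    rw [mem_strings] at hp hq
    simp only at hr ⊢
    by_cases hsame : m = m' ∧ diagonal p = diagonal q
    · obtain ⟨rfl, hd⟩ := hsame
      have := sameSide_of_newRes_eq (ε := ε) (t := t) hη.1 hη'.1
        (fun h => hpq (by rw [h])) hr hd
      rw [hd]
      simpa only [add_sub_add_left_eq_sub] using this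
    · have hb : p.2 = q.2 := by
        simp only [newRes] at hr
        cases hb : p.2 <;> cases hb' : q.2
        · rfl
        · exact absurd (by simpa [hb, hb'] using hr) (relabel_ne_one _)
        · exact absurd (by simpa [hb, hb'] using hr.symm) (relabel_ne_one _)
        · rfl
      obtain ⟨hu1, hu2, -⟩ := startShift_bounds (ρ := ρ) he hη h hp
      obtain ⟨hu1', hu2', -⟩ := startShift_bounds (ρ := ρ) he hη h hq
      obtain ⟨hv1, hv2⟩ := endShift_bounds he hη h hη' hp
      obtain ⟨hv1', hv2'⟩ := endShift_bounds he hη h hη' hq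
      exact sameSide_of_base he hκ hp hq (by simp [diagonal, hb]) hsame hM
        ⟨hu1, by linarith⟩ ⟨hu1', by linarith⟩ ⟨hv1, by linarith⟩ ⟨hv1', by linarith⟩
  · rintro ⟨m, p⟩ hp ⟨m', q⟩ hq hr
    rw [mem_strings] at hp hq
    have hshift : (subdivide t ε δ (partitionIdempotent (fun _ : ZMod (e + 1) => 1) κ ρ η
        lam)).shift (newRes (ρ m) p) = if p.2 then ε else 1 := subdivideShift_newRes ε (ρ m) p
    simp only at hr ⊢
    rw [hshift]
    -- A unit ghost shift moves to the next diagonal, whereas the shift `ε` of an added string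
    -- counts as part of the small term.
    have hbase : ∀ M u : ℝ, base κ M m (diagonal p) + u + (if p.2 then ε else 1)
        = base κ M m (diagonal p + if p.2 then 0 else 1) + (u + if p.2 then ε else 0) := by
      intro M u
      split_ifs
      · rw [add_zero, add_assoc]
      · rw [base_add_one]
        ring
    rw [hbase, hbase]
    by_cases hsame : m = m' ∧ (diagonal p + if p.2 then 0 else 1) = diagonal q
    · obtain ⟨rfl, hd⟩ := hsame
      have := sameSide_of_newRes_add_one h hη'.1 hp hq hr hd
      rw [hd]
      simpa only [add_sub_add_left_eq_sub] using this
    · obtain ⟨hu1, hu2, -⟩ := startShift_bounds (ρ := ρ) he hη h hp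
      obtain ⟨hu1', hu2', -⟩ := startShift_bounds (ρ := ρ) he hη h hq
      obtain ⟨hv1, hv2⟩ := endShift_bounds he hη h hη' hp
      obtain ⟨hv1', hv2'⟩ := endShift_bounds he hη h hη' hq
      have hε' : 0 ≤ (if p.2 then ε else 0) ∧ (if p.2 then ε else 0) ≤ ε := by
        split_ifs <;> constructor <;> linarith
      refine sameSide_of_base he hκ hp hq ?_ hsame hM
        ⟨by linarith, by linarith⟩ ⟨hu1', by linarith⟩ ⟨by linarith, by linarith⟩
        ⟨hv1', by linarith⟩
      simp only [diagonal]
      cases p.2 <;> cases q.2 <;> simp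
  · rintro ⟨m, p⟩ hp m' hr
    rw [mem_strings] at hp
    have hb : p.2 = false := by
      by_contra hb
      have hr : newRes (ρ m) p = relabel (ρ m') := hr
      rw [newRes, if_pos (by simpa using hb)] at hr
      exact relabel_ne_one _ hr.symm
    exact sameSide_red he hκ hη h hη' m' hp hb hM

end Comparison

end KLRW

end

theorem mainTheorem2 (e ℓ : ℕ) (he : 1 ≤ e) (lam : Fin ℓ → YoungDiagram)
    (ρ : Fin ℓ → ZMod (e + 1)) (κ : Fin ℓ → ℤ) (hκ : KLRW.IsAsymptotic (KLRW.size lam) κ)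
    (η : ℝ) (hη : KLRW.IsSpacing (fun _ : ZMod (e + 1) => 1) lam η)
    (δ : ℝ) (hδ : η < δ) (hδ' : δ ≤ 1 / 2)
    (t ε : ℝ) (h : KLRW.IsHomogeneous η t ε) :
    ∃ mu : Fin ℓ → YoungDiagram, KLRW.IsPlus ρ lam mu ∧
      ∀ η' : ℝ, KLRW.IsSpacing (KLRW.subdivideShift ε (fun _ : ZMod (e + 1) => 1)) mu η' →
        (KLRW.subdivide t ε δ
            (KLRW.partitionIdempotent (fun _ : ZMod (e + 1) => 1) κ ρ η lam)).Equivalent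
          (KLRW.partitionIdempotent (KLRW.subdivideShift ε (fun _ : ZMod (e + 1) => 1)) κ
            (fun m => KLRW.relabel (ρ m)) η' mu) :=
  ⟨fun m => KLRW.plusDiagram (ρ m) (lam m), KLRW.isPlus_plusDiagram he ρ lam,
    fun _ hη' => KLRW.subdivide_equivalent he hκ hη hδ hδ' h hη'⟩
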